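/- Let $G\subset GL_m(\mathbb{C})$ be a complex semisimple linear algebraic group (a Zariski closed subgroup with semisimple Lie algebra $\mathfrak g\subset\mathfrak{gl}_m(\mathbb C)$). Let $\mathfrak b\subset\mathfrak g$ be a Borel subalgebra (a maximal solvable subalgebra), $\mathfrak h\subset\mathfrak b$ a Cartan subalgebra of $\mathfrak g$, and $\mathfrak n$ the nilradical of $\mathfrak b$ (its largest nilpotent ideal). Let $\Delta_+$ be the set of positive roots, i.e. the roots of $(\mathfrak g,\mathfrak h)$ whose root spaces lie in $\mathfrak b$, and put $$\mathfrak h'=\{h\in\mathfrak h:\alpha(h)\ne 0\ \ \forall\,\alpha\in\Delta_+\},\qquad \mathfrak b'=\mathfrak h'+\mathfrak n .$$ Let $N$ be the unipotent subgroup corresponding to $\mathfrak n$, i.e. the subgroup generated by the matrices $e^z$, $z\in\mathfrak n$. Then $N\subset G$, $N$ is an embedded complex submanifold of the space of $m\times m$ matrices, $\mathfrak h'$ is open in $\mathfrak h$, $\mathfrak b'$ is open in $\mathfrak b$, and the action map $$N\times\mathfrak h'\to\mathfrak b',\qquad (g,h)\mapsto \mathrm{Ad}(g)h=ghg^{-1},$$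 is an isomorphism of complex manifolds. Moreover $N\times\mathfrak h$ and $\mathfrak b$ are irreducible affine varieties, and the map $N\times\mathfrak h\to\mathfrak b$ given by the same formula is a morphism of varieties which is a birational equivalence, i.e. it restricts to an isomorphism between non-empty Zariski open subsets of $N\times\mathfrak h$ and of $\mathfrak b$. -/

import Mathlib

open scoped Manifold ContDiff

attribute [local instance] LieRing.ofAssociativeRing

noncomputable section

namespace AdjointAction

/-! ### Linear algebraic groups and their Lie algebras -/

/-- Complex `m × m` matrices, with the commutator bracket and the usual topology. -/
abbrev Mat (m : ℕ) : Type := Matrix (Fin m) (Fin m) ℂ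

/-- Polynomials in the entries of an `m × m` matrix. -/
abbrev MatPoly (m : ℕ) : Type := MvPolynomial (Fin m × Fin m) ℂ

/-- The value of a polynomial in the matrix entries at a matrix. -/
def evalMat {m : ℕ} (A : Mat m) (p : MatPoly m) : ℂ :=
  MvPolynomial.eval (fun ij : Fin m × Fin m => A ij.1 ij.2) p

/-- `G ⊆ GL_m(ℂ)` is Zariski closed, i.e. it is a linear algebraic group. -/
def IsAlgebraicGroup {m : ℕ} (G : Subgroup (GL (Fin m) ℂ)) : Prop :=
  ∃ S : Set (MatPoly m), ∀ g : GL (Fin m) ℂ, g ∈ G ↔ ∀ p ∈ S, evalMat (g : Mat m) p = 0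

/-- `p` vanishes at all points of `G`. -/
def VanishesOn {m : ℕ} (G : Subgroup (GL (Fin m) ℂ)) (p : MatPoly m) : Prop :=
  ∀ g ∈ G, evalMat (g : Mat m) p = 0

/-- The left-invariant vector field on `m × m` matrices with value `A * X` at the matrix `A`,
as a derivation: it sends the coordinate function `A ↦ A i j` to `A ↦ (A * X) i j`. -/
def leftInvariantDerivation {m : ℕ} (X : Mat m) : Derivation ℂ (MatPoly m) (MatPoly m) :=
  MvPolynomial.mkDerivation ℂ fun ij =>
    ∑ k, MvPolynomial.C (X k ij.2) * MvPolynomial.X (ij.1, k)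

lemma leftInvariantDerivation_add {m : ℕ} (X Y : Mat m) :
    leftInvariantDerivation (X + Y) = leftInvariantDerivation X + leftInvariantDerivation Y := by
  apply MvPolynomial.derivation_ext
  intro ij
  simp [leftInvariantDerivation, MvPolynomial.mkDerivation_X, add_mul, Finset.sum_add_distrib]

lemma leftInvariantDerivation_smul {m : ℕ} (c : ℂ) (X : Mat m) :
    leftInvariantDerivation (c • X) = c • leftInvariantDerivation X := by
  apply MvPolynomial.derivation_ext
  intro ij
  simp [leftInvariantDerivation, MvPolynomial.mkDerivation_X, Finset.smul_sum,
    MvPolynomial.smul_eq_C_mul, mul_assoc]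

lemma leftInvariantDerivation_X {m : ℕ} (X : Mat m) (i j : Fin m) :
    leftInvariantDerivation X (MvPolynomial.X (i, j)) =
      ∑ k, MvPolynomial.C (X k j) * MvPolynomial.X (i, k) :=
  MvPolynomial.mkDerivation_X _ _ _

lemma leftInvariantDerivation_leftInvariantDerivation_X {m : ℕ} (X Y : Mat m) (i j : Fin m) :
    leftInvariantDerivation X (leftInvariantDerivation Y (MvPolynomial.X (i, j))) =
      ∑ l, MvPolynomial.C ((X * Y) l j) * MvPolynomial.X (i, l) := by
  rw [leftInvariantDerivation_X, map_sum]
  have key (k : Fin m) : leftInvariantDerivation X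
      (MvPolynomial.C (Y k j) * MvPolynomial.X (i, k)) =
      ∑ l, MvPolynomial.C (Y k j) * (MvPolynomial.C (X l k) * MvPolynomial.X (i, l)) := by
    rw [← MvPolynomial.smul_eq_C_mul, Derivation.map_smul, leftInvariantDerivation_X,
      MvPolynomial.smul_eq_C_mul, Finset.mul_sum]
  rw [Finset.sum_congr rfl fun k _ => key k, Finset.sum_comm]
  refine Finset.sum_congr rfl fun l _ => ?_
  rw [Matrix.mul_apply, map_sum, Finset.sum_mul]
  refine Finset.sum_congr rfl fun k _ => ?_
  rw [MvPolynomial.C_mul]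
  ring

lemma leftInvariantDerivation_lie {m : ℕ} (X Y : Mat m) :
    leftInvariantDerivation ⁅X, Y⁆ = ⁅leftInvariantDerivation X, leftInvariantDerivation Y⁆ := by
  apply MvPolynomial.derivation_ext
  rintro ⟨i, j⟩
  rw [Derivation.commutator_apply, leftInvariantDerivation_leftInvariantDerivation_X,
    leftInvariantDerivation_leftInvariantDerivation_X, leftInvariantDerivation_X,
    ← Finset.sum_sub_distrib]
  refine Finset.sum_congr rfl fun k _ => ?_
  rw [LieRing.of_associative_ring_bracket, Matrix.sub_apply, MvPolynomial.C_sub, sub_mul]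

/-- The Lie algebra of a linear algebraic group `G ⊆ GL_m(ℂ)`: the matrices `X` whose
left-invariant vector field preserves the vanishing ideal of `G`. -/
def lieAlgebraOf {m : ℕ} (G : Subgroup (GL (Fin m) ℂ)) : LieSubalgebra ℂ (Mat m) where
  carrier := {X | ∀ p, VanishesOn G p → VanishesOn G (leftInvariantDerivation X p)}
  zero_mem' := by
    intro p _ g _
    have h0 : leftInvariantDerivation (0 : Mat m) = 0 := by
      simpa using leftInvariantDerivation_smul (0 : ℂ) (0 : Mat m)
    simp [h0, evalMat]
  add_mem' := by
    intro X Y hX hY p hp g hg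
    have h1 := hX p hp g hg
    have h2 := hY p hp g hg
    simp only [evalMat] at h1 h2
    simp [leftInvariantDerivation_add, evalMat, h1, h2]
  smul_mem' := by
    intro c X hX p hp g hg
    have h1 := hX p hp g hg
    simp only [evalMat] at h1
    simp [leftInvariantDerivation_smul, evalMat, h1]
  lie_mem' := by
    intro X Y hX hY p hp g hg
    have h1 := hX _ (hY p hp) g hg
    have h2 := hY _ (hX p hp) g hg
    simp only [evalMat] at h1 h2
    simp [leftInvariantDerivation_lie, Derivation.commutator_apply, evalMat, h1, h2]

/-! ### Borel subalgebras, nilradicals, positive roots -/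

/-- A Borel subalgebra is a maximal solvable subalgebra. -/
def IsBorel {L : Type*} [LieRing L] [LieAlgebra ℂ L] (b : LieSubalgebra ℂ L) : Prop :=
  Maximal (fun K : LieSubalgebra ℂ L => LieAlgebra.IsSolvable K) b

/-- The nilradical of a Lie algebra: the largest ideal that is nilpotent as a Lie algebra, i.e.
the sum of all such ideals. (Mathlib's `maxNilpotentIdeal` is a different ideal: it is built from
the ideals on which the whole Lie algebra acts nilpotently.) -/
def lieNilradical (L : Type*) [LieRing L] [LieAlgebra ℂ L] : LieIdeal ℂ L :=
  sSup {I | LieRing.IsNilpotent I}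

/-- The positive roots with respect to `h ⊆ b`: the roots whose root space lies in `b`. -/
def positiveRoots {L : Type*} [LieRing L] [LieAlgebra ℂ L] (h b : LieSubalgebra ℂ L)
    [LieRing.IsNilpotent h] : Set (LieModule.Weight ℂ h L) :=
  {α | α.IsNonZero ∧ (LieAlgebra.rootSpace h α).toSubmodule ≤ b.toSubmodule}

section Subspaces

variable {m : ℕ} {G : Subgroup (GL (Fin m) ℂ)}

/-- A subalgebra of the Lie algebra of `G`, as a space of matrices. -/
def matSpace (K : LieSubalgebra ℂ (lieAlgebraOf G)) : Submodule ℂ (Mat m) :=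
  K.toSubmodule.map (lieAlgebraOf G).incl.toLinearMap

/-- The nilradical `n` of `b`, as a space of matrices. -/
def nilSpace (b : LieSubalgebra ℂ (lieAlgebraOf G)) : Submodule ℂ (Mat m) :=
  ((lieNilradical b).toSubmodule.map b.incl.toLinearMap).map (lieAlgebraOf G).incl.toLinearMap

/-- The regular part `h'` of `h`: the elements at which no positive root vanishes. -/
def regularPart (h b : LieSubalgebra ℂ (lieAlgebraOf G)) [LieRing.IsNilpotent h] : Set (Mat m) :=
  {X | ∃ x : h, (∀ α ∈ positiveRoots h b, α x ≠ 0) ∧ ((x : lieAlgebraOf G) : Mat m) = X}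

/-- `b' = h' + n`. -/
def borelRegularPart (h b : LieSubalgebra ℂ (lieAlgebraOf G)) [LieRing.IsNilpotent h] :
    Set (Mat m) :=
  {Y | ∃ X ∈ regularPart h b, ∃ Z ∈ nilSpace b, X + Z = Y}

/-- The unipotent subgroup `N` corresponding to the nilradical `n` of `b`: the connected subgroup
with Lie algebra `n`, that is, the subgroup generated by the exponentials of the elements of `n`. -/
def unipotentSubgroup (b : LieSubalgebra ℂ (lieAlgebraOf G)) : Subgroup (GL (Fin m) ℂ) :=
  Subgroup.closure {g | ∃ Z ∈ nilSpace b, (g : Mat m) = NormedSpace.exp Z}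

end Subspaces

/-! ### Manifold structure -/

/-- The complex vector space of arrays `Fin m → Fin m → ℂ`, which has Mathlib's standard structure
of a normed space and hence of a complex manifold; `Matrix.of` identifies it with `Mat m`. -/
abbrev Coord (m : ℕ) : Type := Fin m → Fin m → ℂ

/-- A space of matrices, regarded as a normed space (and hence as a complex manifold). -/
def coordSpace {m : ℕ} (S : Submodule ℂ (Mat m)) : Submodule ℂ (Coord m) :=
  S.map (Matrix.ofLinearEquiv ℂ).symm.toLinearMap

/-- The matrix corresponding to a point of `coordSpace S`. -/
def toMat {m : ℕ} {S : Submodule ℂ (Mat m)} (x : coordSpace S) : Mat m :=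
  Matrix.of (x : Coord m)

/-- The inclusion of a subgroup of `GL_m(ℂ)` into the space of matrices. -/
def inclusion {m : ℕ} (N : Subgroup (GL (Fin m) ℂ)) (g : N) : Coord m :=
  Matrix.of.symm ((g : GL (Fin m) ℂ) : Mat m)

/-- The given charts make the subgroup `N ⊆ GL_m(ℂ)` an embedded complex submanifold of the space
of matrices: a complex manifold whose inclusion is a topological embedding and a holomorphic
immersion. Such a structure is unique. -/
structure IsEmbeddedSubmanifold {m : ℕ} (E : Type*) [NormedAddCommGroup E] [NormedSpace ℂ E]
    (N : Subgroup (GL (Fin m) ℂ)) [ChartedSpace E N] : Prop where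
  isManifold : IsManifold 𝓘(ℂ, E) ω N
  isEmbedding : Topology.IsEmbedding (inclusion N)
  contMDiff : ContMDiff 𝓘(ℂ, E) 𝓘(ℂ, Coord m) ω (inclusion N)
  injective_mfderiv : ∀ g : N, Function.Injective
    (mfderiv 𝓘(ℂ, E) 𝓘(ℂ, Coord m) (inclusion N) g)

/-! ### Affine varieties and birational equivalences -/

section Varieties

variable {V W : Type*} [AddCommGroup V] [Module ℂ V] [AddCommGroup W] [Module ℂ W]

/-- Polynomial functions on a complex vector space: the algebra generated by linear forms. -/
def polyFun (V : Type*) [AddCommGroup V] [Module ℂ V] : Subalgebra ℂ (V → ℂ) :=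
  Algebra.adjoin ℂ {f | ∃ l : Module.Dual ℂ V, f = fun v => l v}

/-- `X ⊆ V` is an irreducible affine variety: the zero set of a family of polynomial functions,
non-empty, with prime vanishing ideal. -/
def IsAffineVariety (X : Set V) : Prop :=
  (∃ S : Set (V → ℂ), S ⊆ polyFun V ∧ X = {v | ∀ f ∈ S, f v = 0}) ∧ X.Nonempty ∧
    ∀ f ∈ polyFun V, ∀ g ∈ polyFun V, (∀ v ∈ X, f v * g v = 0) →
      (∀ v ∈ X, f v = 0) ∨ (∀ v ∈ X, g v = 0)

/-- `U` is a Zariski open subset of `X`. -/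
def IsZariskiOpenIn (X U : Set V) : Prop :=
  ∃ S : Set (V → ℂ), S ⊆ polyFun V ∧ U = {v | v ∈ X ∧ ∃ f ∈ S, f v ≠ 0}

/-- `F` is a regular map on `U`: its coordinates are locally quotients of polynomial functions. -/
def IsRegularMapOn (U : Set V) (F : V → W) : Prop :=
  ∀ l : Module.Dual ℂ W, ∀ u ∈ U, ∃ p ∈ polyFun V, ∃ q ∈ polyFun V,
    q u ≠ 0 ∧ ∀ v ∈ U, q v ≠ 0 → l (F v) = p v / q v

/-- `F` is a morphism from the irreducible variety `X` to the irreducible variety `Y` which is a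
birational equivalence: it restricts to an isomorphism of a non-empty open subset of `X` with a
non-empty open subset of `Y`. -/
def IsBirationalEquivalence (X : Set V) (Y : Set W) (F : V → W) : Prop :=
  IsAffineVariety X ∧ IsAffineVariety Y ∧ Set.MapsTo F X Y ∧ IsRegularMapOn X F ∧
    ∃ U U', U.Nonempty ∧ U'.Nonempty ∧ IsZariskiOpenIn X U ∧ IsZariskiOpenIn Y U' ∧
      Set.BijOn F U U' ∧ ∃ F' : W → V, Set.InvOn F' F U U' ∧ IsRegularMapOn U' F'

end Varieties

end AdjointAction

end

open AdjointAction

noncomputable section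

/-! Everything rests on a normal form: for regular `x` in `h` and any `z` in `n` there is exactly
one `g` in `N` with `g x g⁻¹ = x + z`, and `g` depends polynomially on `z` and rationally on `x`,
the only denominators being powers of the determinant of `ad x` on `n`.

Lie theory supplies the setting: `n = [b, b]` (`lieNilradical_eq_derivedSeries`), `b = h ⊕ n`, and
no positive root vanishes at `x` exactly when `ad x` is injective on `n`
(`forall_positiveRoots_iff`).

Existence: by Lie's theorem `b` preserves a flag of `ℂ^m` whose steps are lowered by `[b, b]`, so
matrices are filtered multiplicatively by how far they lower the flag (`exists_filtration`). For
regular `x`, the inverse of `ad x` on `n` respects this filtration. If `[x, w] = y`, conjugating `x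
+ y` by `e^w` removes `y` and leaves an error of strictly higher degree, so finitely many
corrections suffice (`exists_approx_conj`). Each correction uses only Cramer's rule and truncated
exponentials, hence stays inside whatever algebra of functions contains the data: polynomials for
fixed `x`, regular functions for varying `x`.

Uniqueness: let `g` in `N` commute with a regular `x`. Then `log g` lies in the Lie algebra of `G`
and normalizes `b`, hence lies in `b`; it commutes with `x`, hence lies in `h`; it is both
ad-nilpotent and ad-semisimple, hence zero (`eq_one_of_commute_regular`).

Fixing one regular `x`, the map `g ↦ g x g⁻¹ - x` from `N` to `n` is a bijection, polynomial in both
directions since `g⁻¹` is a finite geometric series in `g`. This yields at once a global holomorphic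
chart of `N` and polynomial equations for `N`, without any product formula for exponentials. Letting
`x` vary, the inverse of the action sends `y` to the conjugating element together with the
`h`-component of `y`; it is holomorphic and regular wherever the determinant is nonzero. -/

namespace AdjointAction

/-! ### Truncated exponentials of nilpotent matrices and conjugation by them. -/

section Exponential

variable {m : ℕ}

/-- The exponential series truncated after `c` terms. -/
def texp (c : ℕ) (w : Mat m) : Mat m :=
  ∑ j ∈ Finset.range c, (j.factorial : ℂ)⁻¹ • w ^ j

lemma texp_eq_nilpotentExp {c : ℕ} {w : Mat m} (hw : w ^ c = 0) :
    texp c w = IsNilpotent.exp w := by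
  rw [IsNilpotent.exp_eq_sum hw, texp]
  refine Finset.sum_congr rfl fun j _ => ?_
  ext i k
  simp [Algebra.smul_def]

lemma texp_eq_exp {c : ℕ} {w : Mat m} (hw : w ^ c = 0) : texp c w = NormedSpace.exp w := by
  rw [NormedSpace.exp_eq_tsum ℂ]
  simp only
  rw [tsum_eq_sum (s := Finset.range c), texp]
  intro j hj
  rw [pow_eq_zero_of_le (by simpa using hj) hw, smul_zero]

lemma texp_mul_texp_neg {c : ℕ} {w : Mat m} (hw : w ^ c = 0) : texp c w * texp c (-w) = 1 := by
  have hw' : (-w) ^ c = 0 := by rw [neg_pow, hw, mul_zero]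
  rw [texp_eq_nilpotentExp hw, texp_eq_nilpotentExp hw',
    IsNilpotent.exp_mul_exp_neg_self ⟨c, hw⟩]

lemma texp_neg_mul_texp {c : ℕ} {w : Mat m} (hw : w ^ c = 0) : texp c (-w) * texp c w = 1 := by
  have hw' : (-w) ^ c = 0 := by rw [neg_pow, hw, mul_zero]
  simpa using texp_mul_texp_neg hw'

lemma ad_eq_mulLeft_sub_mulRight (w : Mat m) :
    (LieAlgebra.ad ℂ (Mat m) w : Module.End ℂ (Mat m)) =
      LinearMap.mulLeft ℂ w + -LinearMap.mulRight ℂ w := by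
  ext1 y
  simp [LieRing.of_associative_ring_bracket, sub_eq_add_neg]

lemma nilpotentExp_mulLeft {c : ℕ} {w : Mat m} (hw : w ^ c = 0) (y : Mat m) :
    IsNilpotent.exp (LinearMap.mulLeft ℂ w) y = texp c w * y := by
  rw [IsNilpotent.exp_eq_sum (k := c) (by rw [LinearMap.pow_mulLeft, hw]; ext1; simp), texp,
    Finset.sum_mul, LinearMap.sum_apply]
  refine Finset.sum_congr rfl fun j _ => ?_
  rw [LinearMap.smul_apply, LinearMap.pow_mulLeft, LinearMap.mulLeft_apply, smul_mul_assoc]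
  ext i k
  simp [Algebra.smul_def]

lemma nilpotentExp_neg_mulRight {c : ℕ} {w : Mat m} (hw : w ^ c = 0) (y : Mat m) :
    IsNilpotent.exp (-LinearMap.mulRight ℂ w) y = y * texp c (-w) := by
  have e : -LinearMap.mulRight ℂ w = LinearMap.mulRight ℂ (-w) := by ext1; simp
  have hw' : (-w) ^ c = 0 := by rw [neg_pow, hw, mul_zero]
  rw [e, IsNilpotent.exp_eq_sum (k := c) (by rw [LinearMap.pow_mulRight, hw']; ext1; simp), texp,
    Finset.mul_sum, LinearMap.sum_apply]
  refine Finset.sum_congr rfl fun j _ => ?_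
  rw [LinearMap.smul_apply, LinearMap.pow_mulRight, LinearMap.mulRight_apply, mul_smul_comm]
  ext i k
  simp [Algebra.smul_def]

/-- Conjugation by the exponential of a nilpotent matrix is the exponential of its adjoint
action. -/
lemma texp_conj {c : ℕ} {w : Mat m} (hw : w ^ c = 0) :
    ∃ M : ℕ, ∀ K, M ≤ K → ∀ y : Mat m, texp c w * y * texp c (-w) =
      ∑ j ∈ Finset.range K, (j.factorial : ℚ)⁻¹ • ((LieAlgebra.ad ℂ (Mat m) w) ^ j) y := by
  obtain ⟨M, hM⟩ := LieAlgebra.ad_nilpotent_of_nilpotent (R := ℂ) (a := w) ⟨c, hw⟩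
  refine ⟨M, fun K hK y => ?_⟩
  have hL : IsNilpotent (LinearMap.mulLeft ℂ w) :=
    ⟨c, by rw [LinearMap.pow_mulLeft, hw]; ext1; simp⟩
  have hR : IsNilpotent (-LinearMap.mulRight ℂ w) :=
    IsNilpotent.neg ⟨c, by rw [LinearMap.pow_mulRight, hw]; ext1; simp⟩
  have h1 := IsNilpotent.exp_eq_sum (pow_eq_zero_of_le hK hM)
  -- `ad w` is left multiplication minus right multiplication; these commute and are nilpotent, so
  -- the exponential of `ad w` factors into the two one-sided multiplications.
  have h2 := IsNilpotent.exp_add_of_commute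
    ((LinearMap.commute_mulLeft_right (R := ℂ) w w).neg_right) hL hR
  rw [← ad_eq_mulLeft_sub_mulRight] at h2
  have h3 := LinearMap.congr_fun (h1.symm.trans h2) y
  rw [Module.End.mul_apply, nilpotentExp_neg_mulRight hw, nilpotentExp_mulLeft hw,
    LinearMap.sum_apply] at h3
  rw [mul_assoc, ← h3]
  rfl

lemma ad_pow_mem {W : Submodule ℂ (Mat m)} {w y : Mat m} (hW : ∀ u ∈ W, ⁅w, u⁆ ∈ W)
    (hy : y ∈ W) (j : ℕ) : ((LieAlgebra.ad ℂ (Mat m) w) ^ j) y ∈ W := by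
  induction j with
  | zero => simpa using hy
  | succ j ih =>
    rw [pow_succ', Module.End.mul_apply, LieAlgebra.ad_apply]
    exact hW _ ih

lemma texp_conj_sub_mem {c : ℕ} {w : Mat m} (hw : w ^ c = 0) {W : Submodule ℂ (Mat m)}
    (hW : ∀ u ∈ W, ⁅w, u⁆ ∈ W) {y : Mat m} (hy : ⁅w, y⁆ ∈ W) :
    texp c w * y * texp c (-w) - y ∈ W := by
  obtain ⟨M, hM⟩ := texp_conj hw
  rw [hM (M + 1) (Nat.le_succ M), Finset.sum_range_succ']
  simp only [Nat.factorial_zero, Nat.cast_one, inv_one, pow_zero, one_smul,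
    Module.End.one_apply, add_sub_cancel_right]
  refine Submodule.sum_mem _ fun j _ => Submodule.smul_of_tower_mem _ _ ?_
  rw [pow_succ, Module.End.mul_apply, LieAlgebra.ad_apply]
  exact ad_pow_mem hW hy j

/-- If `[w, x] = -z`, then conjugation by `e ^ w` moves `x + z` to `x` up to higher order terms. -/
lemma texp_conj_add_sub_mem {c : ℕ} {w x z : Mat m} (hw : w ^ c = 0) {W : Submodule ℂ (Mat m)}
    (hW : ∀ u ∈ W, ⁅w, u⁆ ∈ W) (hx : ⁅w, x⁆ = -z) (hz : ⁅w, z⁆ ∈ W) :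
    texp c w * (x + z) * texp c (-w) - x ∈ W := by
  obtain ⟨M, hM⟩ := texp_conj hw
  have h1 : texp c w * z * texp c (-w) - z ∈ W := texp_conj_sub_mem hw hW hz
  have h2 : texp c w * x * texp c (-w) - x + z ∈ W := by
    -- Two extra terms allow the orders zero and one to be split off: they are `x` and `[w, x] =
    -- -z`, and the second cancels the added `z`.
    rw [hM (M + 2) (by omega), Finset.sum_range_succ', Finset.sum_range_succ']
    have e : (LieAlgebra.ad ℂ (Mat m) w) x = -z := by rw [LieAlgebra.ad_apply, hx]
    simp only [zero_add, Nat.factorial_one, Nat.factorial_zero, Nat.cast_one, inv_one, pow_zero,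
      one_smul, pow_one, Module.End.one_apply, e]
    have : ∀ s : Mat m, s + -z + x - x + z = s := fun s => by abel
    rw [this]
    refine Submodule.sum_mem _ fun j _ => Submodule.smul_of_tower_mem _ _ ?_
    rw [pow_succ, pow_succ, Module.End.mul_apply, Module.End.mul_apply, e, map_neg, map_neg]
    exact W.neg_mem (ad_pow_mem hW hz j)
  have := W.add_mem h1 h2
  convert this using 1
  rw [mul_add, add_mul]
  abel

end Exponential

/-! ### Split solvable spaces of matrices with a nilpotent filtration -/

/-- Spaces of matrices `B = H ⊕ n` with `[B, n] ⊆ n`, together with a multiplicative filtration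
with respect to which `n` has degree one and `B` has degree zero. -/
structure FilteredSplitting {m : ℕ} (H n B : Submodule ℂ (Mat m)) (c : ℕ)
    (F : ℕ → Submodule ℂ (Mat m)) : Prop where
  sup_eq : H ⊔ n = B
  disjoint : Disjoint H n
  lie_mem : ∀ x ∈ B, ∀ z ∈ n, ⁅x, z⁆ ∈ n
  antitone : Antitone F
  le_one : n ≤ F 1
  pos : 0 < c
  eq_bot : F c = ⊥
  filtration_mul_mem : ∀ k l, ∀ a ∈ F k, ∀ b ∈ F l, a * b ∈ F (k + l)
  lie_filtration_mem : ∀ k, ∀ x ∈ B, ∀ a ∈ F k, ⁅x, a⁆ ∈ F k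

/-- The subgroup generated by the exponentials of the matrices in `n`. -/
def expGroup {m : ℕ} (n : Submodule ℂ (Mat m)) : Subgroup (GL (Fin m) ℂ) :=
  Subgroup.closure {g | ∃ Z ∈ n, (g : Mat m) = NormedSpace.exp Z}

/-- The elements of `H` whose adjoint action on `n` is injective. -/
def regularSet {m : ℕ} (H n : Submodule ℂ (Mat m)) : Set (Mat m) :=
  {x | x ∈ H ∧ ∀ z ∈ n, ⁅x, z⁆ = 0 → z = 0}

/-- The geometric series for the inverse of a unipotent matrix, truncated after `c` terms. -/
def unipotentInv {m : ℕ} (c : ℕ) (g : Mat m) : Mat m :=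
  ∑ j ∈ Finset.range c, (1 - g) ^ j

namespace FilteredSplitting

variable {m : ℕ} {H n B : Submodule ℂ (Mat m)} {c : ℕ} {F : ℕ → Submodule ℂ (Mat m)}

lemma n_le (hS : FilteredSplitting H n B c F) : n ≤ B := hS.sup_eq ▸ le_sup_right

lemma h_le (hS : FilteredSplitting H n B c F) : H ≤ B := hS.sup_eq ▸ le_sup_left

lemma pow_succ_mem (hS : FilteredSplitting H n B c F) {a : Mat m} (ha : a ∈ F 1) (j : ℕ) :
    a ^ (j + 1) ∈ F (j + 1) := by
  induction j with
  | zero => simpa using ha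
  | succ j ih => rw [pow_succ]; exact hS.filtration_mul_mem _ _ _ ih _ ha

lemma pow_mem_one (hS : FilteredSplitting H n B c F) {a : Mat m} (ha : a ∈ F 1) (j : ℕ) :
    a ^ (j + 1) ∈ F 1 := hS.antitone (by omega) (hS.pow_succ_mem ha j)

lemma pow_eq_zero (hS : FilteredSplitting H n B c F) {a : Mat m} (ha : a ∈ F 1) : a ^ c = 0 := by
  obtain ⟨c, rfl⟩ := Nat.exists_eq_succ_of_ne_zero hS.pos.ne'
  have := hS.pow_succ_mem ha c
  rwa [← Nat.succ_eq_add_one, hS.eq_bot, Submodule.mem_bot] at this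

/-- Since `1 - g` is nilpotent, its geometric series is finite. Inversion on the unipotent group
thereby becomes polynomial, and the formula makes sense at every matrix. -/
lemma val_inv_eq (hS : FilteredSplitting H n B c F) {g : GL (Fin m) ℂ}
    (hg : (g : Mat m) - 1 ∈ F 1) : ((g⁻¹ : GL (Fin m) ℂ) : Mat m) = unipotentInv c (g : Mat m) := by
  have h0 : (1 - (g : Mat m)) ^ c = 0 := by
    apply hS.pow_eq_zero
    rw [← neg_sub]
    exact (F 1).neg_mem hg
  have h1 := mul_neg_geom_sum (1 - (g : Mat m)) c
  rw [h0, sub_sub_cancel, sub_zero] at h1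
  rw [← mul_one ((g⁻¹ : GL (Fin m) ℂ) : Mat m), ← h1, ← mul_assoc, Units.inv_mul, one_mul,
    unipotentInv]

lemma pow_eq_zero_of_mem (hS : FilteredSplitting H n B c F) {w : Mat m} (hw : w ∈ n) :
    w ^ c = 0 := hS.pow_eq_zero (hS.le_one hw)

/-- The exponential of an element of `n`, as an invertible matrix. -/
def expUnit (hS : FilteredSplitting H n B c F) {w : Mat m} (hw : w ∈ n) : GL (Fin m) ℂ where
  val := texp c w
  inv := texp c (-w)
  val_inv := texp_mul_texp_neg (hS.pow_eq_zero_of_mem hw)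
  inv_val := texp_neg_mul_texp (hS.pow_eq_zero_of_mem hw)

lemma expUnit_mem (hS : FilteredSplitting H n B c F) {w : Mat m} (hw : w ∈ n) :
    hS.expUnit hw ∈ expGroup n :=
  Subgroup.subset_closure ⟨w, hw, texp_eq_exp (hS.pow_eq_zero_of_mem hw)⟩

/-- No case for inverses is needed, because the inverse of `e^w` is `e^(-w)` and `n` is closed under
negation. -/
lemma induction_expGroup (hS : FilteredSplitting H n B c F) {p : (g : GL (Fin m) ℂ) → g ∈ expGroup n → Prop}
    (hexp : ∀ w (hw : w ∈ n), p (hS.expUnit hw) (hS.expUnit_mem hw)) (hone : p 1 (one_mem _))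
    (hmul : ∀ x y (hx : x ∈ expGroup n) (hy : y ∈ expGroup n), p x hx → p y hy →
      p (x * y) (mul_mem hx hy))
    {g : GL (Fin m) ℂ} (hg : g ∈ expGroup n) : p g hg := by
  have key : ∀ x : GL (Fin m) ℂ, ∀ Z ∈ n, (x : Mat m) = NormedSpace.exp Z → ∃ w, ∃ hw : w ∈ n,
      x = hS.expUnit hw := fun x Z hZ hx =>
    ⟨Z, hZ, Units.ext (hx.trans (texp_eq_exp (hS.pow_eq_zero_of_mem hZ)).symm)⟩
  induction hg using Subgroup.closure_induction'' with
  | mem x hx =>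
    obtain ⟨Z, hZ, hx⟩ := hx
    obtain ⟨w, hw, rfl⟩ := key x Z hZ hx
    exact hexp w hw
  | inv_mem x hx =>
    obtain ⟨Z, hZ, hx⟩ := hx
    obtain ⟨w, hw, rfl⟩ := key x Z hZ hx
    have h2 : ∀ x (hx : x ∈ expGroup n), x = hS.expUnit (n.neg_mem hw) → p x hx := by
      rintro _ _ rfl
      exact hexp _ _
    exact h2 _ _ (Units.ext rfl)
  | one => exact hone
  | mul x y hx hy h1 h2 => exact hmul x y hx hy h1 h2

lemma sub_one_mem (hS : FilteredSplitting H n B c F) {g : GL (Fin m) ℂ} (hg : g ∈ expGroup n) :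
    (g : Mat m) - 1 ∈ F 1 := by
  induction hg using hS.induction_expGroup with
  | hexp w hw =>
    obtain ⟨d, hd⟩ := Nat.exists_eq_succ_of_ne_zero hS.pos.ne'
    change texp c w - 1 ∈ F 1
    rw [texp, hd, Finset.sum_range_succ']
    simp only [Nat.factorial_zero, Nat.cast_one, inv_one, pow_zero, one_smul, add_sub_cancel_right]
    exact Submodule.sum_mem _ fun j _ => Submodule.smul_mem _ _ (hS.pow_mem_one (hS.le_one hw) j)
  | hone => simp
  | hmul x y hx hy h1 h2 =>
    have : ((x * y : GL (Fin m) ℂ) : Mat m) - 1 =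
        ((x : Mat m) - 1) * ((y : Mat m) - 1) + ((x : Mat m) - 1) + ((y : Mat m) - 1) := by
      rw [Units.val_mul]; noncomm_ring
    rw [this]
    exact add_mem (add_mem (hS.antitone (by omega) (hS.filtration_mul_mem _ _ _ h1 _ h2)) h1) h2

lemma inv_eq (hS : FilteredSplitting H n B c F) {g : GL (Fin m) ℂ} (hg : g ∈ expGroup n) :
    (g : Mat m)⁻¹ = unipotentInv c (g : Mat m) := by
  rw [← hS.val_inv_eq (hS.sub_one_mem hg), Matrix.coe_units_inv]

/-- Every term of positive order in `exp (ad w) y` is an iterated bracket with `w`, hence in the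
ideal `n`. In particular conjugation does not change the `H`-component, which is why that component
can be read off from the image of the action map. -/
lemma conj_sub_mem (hS : FilteredSplitting H n B c F) {g : GL (Fin m) ℂ} (hg : g ∈ expGroup n)
    {y : Mat m} (hy : y ∈ B) : (g : Mat m) * y * (g : Mat m)⁻¹ - y ∈ n := by
  rw [← Matrix.coe_units_inv]
  induction hg using hS.induction_expGroup generalizing y with
  | hexp w hw =>
    refine texp_conj_sub_mem (hS.pow_eq_zero_of_mem hw)
      (fun u hu => hS.lie_mem _ (hS.n_le hw) _ hu) ?_
    rw [← lie_skew]
    exact n.neg_mem (hS.lie_mem _ hy _ hw)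
  | hone => simp
  | hmul x z hx hz h1 h2 =>
    have h3 := h2 hy
    have h4 := h1 (y := (z : Mat m) * y * ((z⁻¹ : GL (Fin m) ℂ) : Mat m))
      (by simpa using B.add_mem (hS.n_le h3) hy)
    convert n.add_mem h4 h3 using 1
    simp [mul_assoc]

lemma conj_mem (hS : FilteredSplitting H n B c F) {g : GL (Fin m) ℂ} (hg : g ∈ expGroup n)
    {y : Mat m} (hy : y ∈ B) : (g : Mat m) * y * (g : Mat m)⁻¹ ∈ B := by
  simpa using B.add_mem (hS.n_le (hS.conj_sub_mem hg hy)) hy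

end FilteredSplitting

/-! ### Polynomial and regular functions -/

section RegularFunctions

variable {V W : Type*} [AddCommGroup V] [Module ℂ V] [AddCommGroup W] [Module ℂ W]

lemma dual_mem_polyFun (l : Module.Dual ℂ V) : (fun v => l v) ∈ polyFun V :=
  Algebra.subset_adjoin ⟨l, rfl⟩

/-- Polynomial functions pull back to any algebra of functions containing the pullbacks of the
linear forms. -/
lemma comp_mem_of_mem_polyFun {X : Type*} {A : Subalgebra ℂ (X → ℂ)} {φ : X → V}
    (hφ : ∀ l : Module.Dual ℂ V, (fun x => l (φ x)) ∈ A) {f : V → ℂ} (hf : f ∈ polyFun V) :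
    (fun x => f (φ x)) ∈ A := by
  induction hf using Algebra.adjoin_induction with
  | mem f hf => obtain ⟨l, rfl⟩ := hf; exact hφ l
  | algebraMap r => exact A.algebraMap_mem r
  | add f g _ _ h1 h2 => exact A.add_mem h1 h2
  | mul f g _ _ h1 h2 => exact A.mul_mem h1 h2

/-- A polynomial function restricted to a line is a polynomial in one variable. -/
lemma exists_polynomial_line {f : V → ℂ} (hf : f ∈ polyFun V) (v u : V) :
    ∃ q : Polynomial ℂ, ∀ t : ℂ, f (v + t • u) = q.eval t := by
  induction hf using Algebra.adjoin_induction with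
  | mem f hf =>
    obtain ⟨l, rfl⟩ := hf
    exact ⟨Polynomial.C (l v) + Polynomial.X * Polynomial.C (l u), fun t => by simp; ring⟩
  | algebraMap r => exact ⟨Polynomial.C r, fun t => by simp⟩
  | add f g _ _ h1 h2 =>
    obtain ⟨p, hp⟩ := h1
    obtain ⟨q, hq⟩ := h2
    exact ⟨p + q, fun t => by simp [hp, hq]⟩
  | mul f g _ _ h1 h2 =>
    obtain ⟨p, hp⟩ := h1
    obtain ⟨q, hq⟩ := h2
    exact ⟨p * q, fun t => by simp [hp, hq]⟩

/-- Restriction to the line joining a point with `f ≠ 0` to a point with `g ≠ 0` reduces the claim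
to `ℂ[t]` being a domain. -/
lemma eq_zero_or_eq_zero_of_polyFun {f g : V → ℂ} (hf : f ∈ polyFun V) (hg : g ∈ polyFun V)
    (hfg : ∀ v, f v * g v = 0) : (∀ v, f v = 0) ∨ ∀ v, g v = 0 := by
  by_contra! hne
  obtain ⟨⟨v, hv⟩, u, hu⟩ := hne
  obtain ⟨p, hp⟩ := exists_polynomial_line hf v (u - v)
  obtain ⟨q, hq⟩ := exists_polynomial_line hg v (u - v)
  have h0 : p * q = 0 := Polynomial.funext fun t => by
    rw [Polynomial.eval_mul, ← hp, ← hq, hfg, Polynomial.eval_zero]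
  rcases mul_eq_zero.mp h0 with h | h
  · exact hv (by simpa [h] using hp 0)
  · exact hu (by simpa [h] using hq 1)

/-- The algebra of functions that are regular on `U`: locally quotients of polynomial functions. -/
def regularFun (U : Set V) : Subalgebra ℂ (V → ℂ) where
  carrier := {f | ∀ u ∈ U, ∃ p ∈ polyFun V, ∃ q ∈ polyFun V,
    q u ≠ 0 ∧ ∀ v ∈ U, q v ≠ 0 → f v = p v / q v}
  mul_mem' := by
    intro f g hf hg u hu
    obtain ⟨p, hp, q, hq, hqu, h⟩ := hf u hu
    obtain ⟨p', hp', q', hq', hqu', h'⟩ := hg u hu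
    refine ⟨p * p', mul_mem hp hp', q * q', mul_mem hq hq', mul_ne_zero hqu hqu', ?_⟩
    intro v hv hne
    rw [Pi.mul_apply] at hne
    rw [Pi.mul_apply, h v hv (left_ne_zero_of_mul hne), h' v hv (right_ne_zero_of_mul hne),
      div_mul_div_comm]
    rfl
  add_mem' := by
    intro f g hf hg u hu
    obtain ⟨p, hp, q, hq, hqu, h⟩ := hf u hu
    obtain ⟨p', hp', q', hq', hqu', h'⟩ := hg u hu
    refine ⟨p * q' + q * p', add_mem (mul_mem hp hq') (mul_mem hq hp'), q * q', mul_mem hq hq',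
      mul_ne_zero hqu hqu', ?_⟩
    intro v hv hne
    rw [Pi.mul_apply] at hne
    rw [Pi.add_apply, h v hv (left_ne_zero_of_mul hne), h' v hv (right_ne_zero_of_mul hne),
      div_add_div _ _ (left_ne_zero_of_mul hne) (right_ne_zero_of_mul hne)]
    rfl
  algebraMap_mem' := by
    intro r u _
    exact ⟨_, (polyFun V).algebraMap_mem r, 1, one_mem _, one_ne_zero, fun v _ _ => by simp⟩

lemma polyFun_le_regularFun (U : Set V) : polyFun V ≤ regularFun U := fun f hf _ _ =>
  ⟨f, hf, 1, one_mem _, one_ne_zero, fun v _ _ => by simp⟩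

lemma inv_mem_regularFun {U : Set V} {f : V → ℂ} (hf : f ∈ polyFun V) (h0 : ∀ u ∈ U, f u ≠ 0) :
    (fun v => (f v)⁻¹) ∈ regularFun U := fun u hu =>
  ⟨1, one_mem _, f, hf, h0 u hu, fun v _ _ => by simp⟩

/-- Regularity constrains values on `U` only; this permits exchanging a matrix inverse for the
geometric series that agrees with it on the unipotent group. -/
lemma regularFun_congr {U : Set V} {f g : V → ℂ} (hf : f ∈ regularFun U)
    (h : ∀ u ∈ U, f u = g u) : g ∈ regularFun U := fun u hu => by
  obtain ⟨p, hp, q, hq, hqu, hpq⟩ := hf u hu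
  exact ⟨p, hp, q, hq, hqu, fun v hv hne => (h v hv).symm.trans (hpq v hv hne)⟩

lemma comp_linearMap_mem_regularFun {U : Set V} {U' : Set W} (φ : W →ₗ[ℂ] V)
    (hφ : Set.MapsTo φ U' U) {f : V → ℂ} (hf : f ∈ regularFun U) :
    (fun w => f (φ w)) ∈ regularFun U' := by
  intro u hu
  obtain ⟨p, hp, q, hq, hqu, h⟩ := hf (φ u) (hφ hu)
  have key : ∀ r ∈ polyFun V, (fun w => r (φ w)) ∈ polyFun W := fun r hr =>
    comp_mem_of_mem_polyFun (fun l => dual_mem_polyFun (l ∘ₗ φ)) hr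
  exact ⟨_, key p hp, _, key q hq, hqu, fun v hv hne => h _ (hφ hv) hne⟩

end RegularFunctions

/-! ### Holomorphy of polynomial and regular functions. -/

section Smooth

variable {E : Type*} [NormedAddCommGroup E] [NormedSpace ℂ E] [FiniteDimensional ℂ E]

lemma contDiff_of_mem_polyFun {f : E → ℂ} (hf : f ∈ polyFun E) : ContDiff ℂ ω f := by
  induction hf using Algebra.adjoin_induction with
  | mem f hf => obtain ⟨l, rfl⟩ := hf; exact (LinearMap.toContinuousLinearMap l).contDiff
  | algebraMap r => exact contDiff_const
  | add f g _ _ h1 h2 => exact h1.add h2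
  | mul f g _ _ h1 h2 => exact h1.mul h2

lemma contDiffOn_of_mem_regularFun {U : Set E} {f : E → ℂ} (hf : f ∈ regularFun U) :
    ContDiffOn ℂ ω f U := by
  intro u hu
  obtain ⟨p, hp, q, hq, hqu, h⟩ := hf u hu
  have h1 : ContDiffWithinAt ℂ ω (fun v => p v / q v) U u :=
    ((contDiff_of_mem_polyFun hp).contDiffAt.div
      (contDiff_of_mem_polyFun hq).contDiffAt hqu).contDiffWithinAt
  refine h1.congr_of_eventuallyEq ?_ (h u hu hqu)
  have h2 : ∀ᶠ v in nhds u, q v ≠ 0 :=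
    (contDiff_of_mem_polyFun hq).continuous.continuousAt.eventually_ne hqu
  filter_upwards [self_mem_nhdsWithin, mem_nhdsWithin_of_mem_nhds h2] with v hv hne
  exact h v hv hne

end Smooth

/-! ### Matrices of functions -/

section MatrixFunctions

variable {X : Type*} {m : ℕ} (A : Subalgebra ℂ (X → ℂ))

/-- The entries of a matrix valued function lie in a given algebra of functions. -/
def EntriesIn {ι κ : Type*} (f : X → Matrix ι κ ℂ) : Prop := ∀ i j, (fun x => f x i j) ∈ A

variable {A}

namespace EntriesIn

variable {ι κ : Type*} {f g : X → Mat m}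

lemma const (a : Matrix ι κ ℂ) : EntriesIn A fun _ => a := fun i j => A.algebraMap_mem (a i j)

lemma add (hf : EntriesIn A f) (hg : EntriesIn A g) : EntriesIn A fun x => f x + g x :=
  fun i j => A.add_mem (hf i j) (hg i j)

lemma neg (hf : EntriesIn A f) : EntriesIn A fun x => -f x := fun i j => A.neg_mem (hf i j)

lemma sub (hf : EntriesIn A f) (hg : EntriesIn A g) : EntriesIn A fun x => f x - g x :=
  fun i j => A.sub_mem (hf i j) (hg i j)

lemma smul (r : ℂ) (hf : EntriesIn A f) : EntriesIn A fun x => r • f x :=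
  fun i j => A.smul_mem (hf i j) r

lemma sum {s : Finset ℕ} {f : ℕ → X → Mat m} (hf : ∀ k, EntriesIn A (f k)) :
    EntriesIn A fun x => ∑ k ∈ s, f k x := by
  intro i j
  simp only [Matrix.sum_apply]
  have := A.sum_mem (t := s) (f := fun k x => f k x i j) fun k _ => hf k i j
  convert this using 1
  ext x
  simp

lemma mul (hf : EntriesIn A f) (hg : EntriesIn A g) : EntriesIn A fun x => f x * g x := by
  intro i j
  have := A.sum_mem (t := Finset.univ) (f := fun k x => f x i k * g x k j)
    fun k _ => A.mul_mem (hf i k) (hg k j)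
  convert this using 1
  ext x
  simp [Matrix.mul_apply]

lemma pow (hf : EntriesIn A f) (k : ℕ) : EntriesIn A fun x => f x ^ k := by
  induction k with
  | zero => simpa using const (A := A) (1 : Mat m)
  | succ k ih => simp only [pow_succ]; exact ih.mul hf

lemma texp (hf : EntriesIn A f) (c : ℕ) : EntriesIn A fun x => AdjointAction.texp c (f x) :=
  sum fun k => (hf.pow k).smul _

lemma unipotentInv (hf : EntriesIn A f) (c : ℕ) :
    EntriesIn A fun x => AdjointAction.unipotentInv c (f x) :=
  sum fun k => ((const 1).sub hf).pow k

lemma dual_mem (hf : EntriesIn A f) (l : Module.Dual ℂ (Mat m)) : (fun x => l (f x)) ∈ A := by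
  have := A.sum_mem (t := Finset.univ) (f := fun (ij : Fin m × Fin m) x =>
    f x ij.1 ij.2 * l (Matrix.single ij.1 ij.2 1)) fun ij _ =>
    A.mul_mem (hf ij.1 ij.2) (A.algebraMap_mem _)
  convert this using 1
  ext x
  conv_lhs => rw [Matrix.matrix_eq_sum_single (f x)]
  simp only [map_sum, Finset.sum_apply, Fintype.sum_prod_type]
  refine Finset.sum_congr rfl fun i _ => Finset.sum_congr rfl fun j _ => ?_
  rw [← smul_eq_mul, ← map_smul, Matrix.smul_single, smul_eq_mul, mul_one]

lemma linearMap (hf : EntriesIn A f) (φ : Mat m →ₗ[ℂ] Mat m) : EntriesIn A fun x => φ (f x) :=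
  fun i j => hf.dual_mem (Matrix.entryLinearMap ℂ ℂ i j ∘ₗ φ)

/-- Evaluating a linear map depending on `x` at a matrix depending on `x`. -/
lemma linearMap_apply {τ : X → Mat m →ₗ[ℂ] Mat m} (hτ : ∀ a, EntriesIn A fun x => τ x a)
    (hf : EntriesIn A f) : EntriesIn A fun x => τ x (f x) := by
  intro i j
  have := A.sum_mem (t := Finset.univ) (f := fun (kl : Fin m × Fin m) x =>
    f x kl.1 kl.2 * τ x (Matrix.single kl.1 kl.2 1) i j) fun kl _ =>
    A.mul_mem (hf kl.1 kl.2) (hτ _ i j)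
  convert this using 1
  ext x
  change τ x (f x) i j = _
  conv_lhs => rw [Matrix.matrix_eq_sum_single (f x)]
  simp only [map_sum, Finset.sum_apply, Fintype.sum_prod_type, Matrix.sum_apply]
  refine Finset.sum_congr rfl fun k _ => Finset.sum_congr rfl fun l _ => ?_
  rw [← mul_one (f x k l), ← smul_eq_mul, ← Matrix.smul_single, map_smul, Matrix.smul_apply]
  simp

section Determinant

variable [Fintype ι] [DecidableEq ι] {M : X → Matrix ι ι ℂ}

lemma det_mem (hM : EntriesIn A M) : (fun x => (M x).det) ∈ A := by
  let M' : Matrix ι ι A := Matrix.of fun i j => ⟨_, hM i j⟩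
  convert M'.det.2 using 1
  ext x
  have := RingHom.map_det ((Pi.evalRingHom (fun _ => ℂ) x).comp A.val.toRingHom) M'
  exact this.symm

lemma adjugate (hM : EntriesIn A M) : EntriesIn A fun x => (M x).adjugate := by
  let M' : Matrix ι ι A := Matrix.of fun i j => ⟨_, hM i j⟩
  intro i j
  convert (M'.adjugate i j).2 using 1
  ext x
  have := RingHom.map_adjugate ((Pi.evalRingHom (fun _ => ℂ) x).comp A.val.toRingHom) M'
  exact (congrFun (congrFun this i) j).symm

end Determinant

end EntriesIn

lemma entriesIn_polyFun_id : EntriesIn (polyFun (Mat m)) fun a => a :=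
  fun i j => dual_mem_polyFun (Matrix.entryLinearMap ℂ ℂ i j)

end MatrixFunctions

/-! ### Inverting the adjoint action of a regular element -/

section Inversion

variable {m : ℕ}

/-- The adjoint action of `x` on the range of the projection `π`, extended by the identity to the
kernel of `π`. -/
def adOn (π : Mat m →ₗ[ℂ] Mat m) (x : Mat m) : Mat m →ₗ[ℂ] Mat m :=
  LieAlgebra.ad ℂ (Mat m) x ∘ₗ π + (LinearMap.id - π)

/-- The matrix of `adOn π x`. -/
def adOnMatrix (π : Mat m →ₗ[ℂ] Mat m) (x : Mat m) :
    Matrix (Fin m × Fin m) (Fin m × Fin m) ℂ :=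
  LinearMap.toMatrix (Matrix.stdBasis ℂ (Fin m) (Fin m)) (Matrix.stdBasis ℂ (Fin m) (Fin m))
    (adOn π x)

/-- The inverse of `adOn π x`, by Cramer's rule. -/
def adOnInv (π : Mat m →ₗ[ℂ] Mat m) (x : Mat m) : Mat m →ₗ[ℂ] Mat m :=
  (adOnMatrix π x).det⁻¹ • Matrix.toLin (Matrix.stdBasis ℂ (Fin m) (Fin m))
    (Matrix.stdBasis ℂ (Fin m) (Fin m)) (adOnMatrix π x).adjugate

lemma adOn_apply (π : Mat m →ₗ[ℂ] Mat m) (x a : Mat m) :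
    adOn π x a = ⁅x, π a⁆ + (a - π a) := rfl

lemma adOn_adOnInv {π : Mat m →ₗ[ℂ] Mat m} {x : Mat m} (hx : (adOnMatrix π x).det ≠ 0)
    (a : Mat m) : adOn π x (adOnInv π x a) = a := by
  have h : adOn π x = Matrix.toLin (Matrix.stdBasis ℂ (Fin m) (Fin m))
    (Matrix.stdBasis ℂ (Fin m) (Fin m)) (adOnMatrix π x) := (Matrix.toLin_toMatrix _ _ _).symm
  rw [adOnInv, LinearMap.smul_apply, map_smul, h, ← LinearMap.comp_apply, ← Matrix.toLin_mul,
    Matrix.mul_adjugate, map_smul, Matrix.toLin_one, LinearMap.smul_apply, smul_smul,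
    inv_mul_cancel₀ hx, one_smul, LinearMap.id_apply]

lemma det_adOnMatrix_ne_zero_iff {π : Mat m →ₗ[ℂ] Mat m} {x : Mat m} :
    (adOnMatrix π x).det ≠ 0 ↔ ∀ a, adOn π x a = 0 → a = 0 := by
  rw [adOnMatrix, LinearMap.det_toMatrix, ← isUnit_iff_ne_zero, ← LinearMap.isUnit_iff_isUnit_det,
    LinearMap.isUnit_iff_ker_eq_bot, LinearMap.ker_eq_bot']

section

variable {X : Type*} {A : Subalgebra ℂ (X → ℂ)} {x : X → Mat m}

lemma EntriesIn.adOnMatrix (hx : EntriesIn A x) (π : Mat m →ₗ[ℂ] Mat m) :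
    EntriesIn A fun v => AdjointAction.adOnMatrix π (x v) := by
  intro p q
  have h := ((hx.mul (.const (π (Matrix.single q.1 q.2 1)))).sub
    ((EntriesIn.const (π (Matrix.single q.1 q.2 1))).mul hx)).add
    (.const (Matrix.single q.1 q.2 1 - π (Matrix.single q.1 q.2 1)))
  convert h p.1 p.2 using 1
  ext v
  change AdjointAction.adOnMatrix π (x v) p q = _
  rw [AdjointAction.adOnMatrix, LinearMap.toMatrix_apply, Matrix.stdBasis_eq_single, adOn_apply,
    LieRing.of_associative_ring_bracket]
  rfl

lemma EntriesIn.adOnInv (hx : EntriesIn A x) (π : Mat m →ₗ[ℂ] Mat m)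
    (hd : (fun v => (AdjointAction.adOnMatrix π (x v)).det⁻¹) ∈ A) (a : Mat m) :
    EntriesIn A fun v => AdjointAction.adOnInv π (x v) a := by
  intro i j
  have h := A.sum_mem (t := Finset.univ) (f := fun (q : Fin m × Fin m) v =>
    (AdjointAction.adOnMatrix π (x v)).det⁻¹ *
      (AdjointAction.adOnMatrix π (x v)).adjugate (i, j) q * a q.1 q.2) fun q _ =>
    A.mul_mem (A.mul_mem hd ((hx.adOnMatrix π).adjugate _ _)) (A.algebraMap_mem (a q.1 q.2))
  convert h using 1
  ext v
  change AdjointAction.adOnInv π (x v) a i j = _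
  rw [AdjointAction.adOnInv, LinearMap.smul_apply, Matrix.smul_apply]
  have e : ∀ N : Matrix (Fin m × Fin m) (Fin m × Fin m) ℂ,
      Matrix.toLin (Matrix.stdBasis ℂ (Fin m) (Fin m)) (Matrix.stdBasis ℂ (Fin m) (Fin m)) N a i j =
        ∑ q, N (i, j) q * a q.1 q.2 := by
    intro N
    have := congrFun (LinearMap.toMatrix_mulVec_repr (Matrix.stdBasis ℂ (Fin m) (Fin m))
      (Matrix.stdBasis ℂ (Fin m) (Fin m)) (Matrix.toLin (Matrix.stdBasis ℂ (Fin m) (Fin m))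
      (Matrix.stdBasis ℂ (Fin m) (Fin m)) N) a) (i, j)
    rw [LinearMap.toMatrix_toLin] at this
    exact this.symm
  rw [e, smul_eq_mul, Finset.mul_sum, Finset.sum_apply]
  refine Finset.sum_congr rfl fun q _ => ?_
  rw [mul_assoc]

end

end Inversion

/-- Projections of the space of matrices onto two independent subspaces, each of which vanishes on
the other subspace. -/
structure SplitProjections {m : ℕ} (H n : Submodule ℂ (Mat m)) (p π : Mat m →ₗ[ℂ] Mat m) :
    Prop where
  fst_mem : ∀ a, p a ∈ H
  fst_of_mem : ∀ x ∈ H, p x = x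
  fst_eq_zero : ∀ z ∈ n, p z = 0
  snd_mem : ∀ a, π a ∈ n
  snd_of_mem : ∀ z ∈ n, π z = z
  snd_eq_zero : ∀ x ∈ H, π x = 0

lemma exists_projection {m : ℕ} {S T : Submodule ℂ (Mat m)} (h : Disjoint S T) :
    ∃ p : Mat m →ₗ[ℂ] Mat m, (∀ a, p a ∈ S) ∧ (∀ x ∈ S, p x = x) ∧ ∀ z ∈ T, p z = 0 := by
  obtain ⟨C, hC, hcompl⟩ := h.symm.exists_isCompl
  refine ⟨S.subtype ∘ₗ S.projectionOnto C hcompl.symm, fun a => Subtype.prop _, fun x hx => ?_,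
    fun z hz => ?_⟩
  · simpa using congrArg Subtype.val (Submodule.projectionOnto_apply_left hcompl.symm ⟨x, hx⟩)
  · simpa using Submodule.projectionOnto_apply_right hcompl.symm ⟨z, hC hz⟩

lemma exists_splitProjections {m : ℕ} {H n : Submodule ℂ (Mat m)} (h : Disjoint H n) :
    ∃ p π, SplitProjections H n p π := by
  obtain ⟨p, h1, h2, h3⟩ := exists_projection h
  obtain ⟨π, h4, h5, h6⟩ := exists_projection h.symm
  exact ⟨p, π, h1, h2, h3, h4, h5, h6⟩

namespace FilteredSplitting

variable {m : ℕ} {H n B : Submodule ℂ (Mat m)} {c : ℕ} {F : ℕ → Submodule ℂ (Mat m)}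
  {p π : Mat m →ₗ[ℂ] Mat m}

lemma fst_add_snd (hS : FilteredSplitting H n B c F) (hP : SplitProjections H n p π) {y : Mat m}
    (hy : y ∈ B) : p y + π y = y := by
  rw [← hS.sup_eq] at hy
  obtain ⟨x, hx, z, hz, rfl⟩ := Submodule.mem_sup.mp hy
  rw [map_add, map_add, hP.fst_of_mem x hx, hP.fst_eq_zero z hz, hP.snd_eq_zero x hx,
    hP.snd_of_mem z hz, add_zero, zero_add]

/-- As `[x, n] ⊆ n`, a vector killed by `adOn π x` must itself lie in `n`. Regularity thus becomes
the nonvanishing of a single polynomial, the source of all openness statements and of the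
denominators. -/
lemma adOn_injective_iff (hS : FilteredSplitting H n B c F) (hP : SplitProjections H n p π)
    {x : Mat m} (hx : x ∈ H) : (adOnMatrix π x).det ≠ 0 ↔ x ∈ regularSet H n := by
  rw [det_adOnMatrix_ne_zero_iff]
  constructor
  · refine fun h => ⟨hx, fun z hz h0 => h z ?_⟩
    rw [adOn_apply, hP.snd_of_mem z hz, h0, sub_self, add_zero]
  · rintro ⟨-, h⟩ a ha
    rw [adOn_apply] at ha
    have h1 : ⁅x, π a⁆ ∈ n := hS.lie_mem x (hS.h_le hx) _ (hP.snd_mem a)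
    have h2 : a - π a ∈ n := by
      rw [← neg_eq_of_add_eq_zero_right ha]
      exact n.neg_mem h1
    have h3 : a ∈ n := by simpa using n.add_mem h2 (hP.snd_mem a)
    rw [hP.snd_of_mem a h3, sub_self, add_zero] at ha
    exact h a h3 ha

lemma adOnInv_mem (hS : FilteredSplitting H n B c F) (hP : SplitProjections H n p π)
    {x z : Mat m} (hx : x ∈ regularSet H n) (hz : z ∈ n) :
    adOnInv π x z ∈ n ∧ ⁅x, adOnInv π x z⁆ = z := by
  have h := adOn_adOnInv ((hS.adOn_injective_iff hP hx.1).mpr hx) z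
  rw [adOn_apply] at h
  set w := adOnInv π x z
  have h1 : ⁅x, π w⁆ ∈ n := hS.lie_mem x (hS.h_le hx.1) _ (hP.snd_mem w)
  have h2 : w - π w ∈ n := by
    rw [← eq_sub_iff_add_eq'] at h
    rw [h]
    exact n.sub_mem hz h1
  have h3 : w ∈ n := by simpa using n.add_mem h2 (hP.snd_mem w)
  rw [hP.snd_of_mem w h3, sub_self, add_zero] at h
  exact ⟨h3, h⟩

/-- `ad x` maps the finite-dimensional space `n ⊓ F k` into itself injectively, hence onto itself.
-/
lemma exists_mem_filtration (hS : FilteredSplitting H n B c F) {x z : Mat m}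
    (hx : x ∈ regularSet H n) {k : ℕ} (hz : z ∈ n) (hzk : z ∈ F k) :
    ∃ w ∈ n ⊓ F k, ⁅x, w⁆ = z := by
  let T : (n ⊓ F k : Submodule ℂ (Mat m)) →ₗ[ℂ] (n ⊓ F k : Submodule ℂ (Mat m)) :=
    (LieAlgebra.ad ℂ (Mat m) x : Mat m →ₗ[ℂ] Mat m).restrict fun w hw =>
      ⟨hS.lie_mem x (hS.h_le hx.1) w hw.1, hS.lie_filtration_mem k x (hS.h_le hx.1) w hw.2⟩
  have hT : Function.Injective T := by
    rw [← LinearMap.ker_eq_bot, LinearMap.ker_eq_bot']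
    rintro ⟨w, hw⟩ h0
    exact Subtype.ext (hx.2 w hw.1 (congrArg Subtype.val h0))
  obtain ⟨⟨w, hw⟩, h⟩ := LinearMap.surjective_of_injective hT ⟨z, hz, hzk⟩
  exact ⟨w, hw, congrArg Subtype.val h⟩

/-- Cramer's rule does not see the filtration, but the solution in `n` is unique, so it coincides
with the one found inside `n ⊓ F k`. -/
lemma adOnInv_mem_filtration (hS : FilteredSplitting H n B c F) (hP : SplitProjections H n p π)
    {x z : Mat m} (hx : x ∈ regularSet H n) {k : ℕ} (hz : z ∈ n) (hzk : z ∈ F k) :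
    adOnInv π x z ∈ F k := by
  obtain ⟨w, hw, h⟩ := hS.exists_mem_filtration hx hz hzk
  obtain ⟨h1, h2⟩ := hS.adOnInv_mem hP hx hz
  have : adOnInv π x z - w = 0 := hx.2 _ (n.sub_mem h1 hw.1) (by rw [lie_sub, h, h2, sub_self])
  rw [sub_eq_zero.mp this]
  exact hw.2

/-- Elements of `expGroup n` conjugating `x` to `x + z`, constructed by successive approximation
along the filtration: the `k`-th approximation conjugates `x + y` to `x + z` with `y ∈ F (k + 1)`.
The construction stays within any algebra of functions containing the entries of the data. -/
lemma exists_approx_conj (hS : FilteredSplitting H n B c F) (hP : SplitProjections H n p π)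
    {X : Type*} {A : Subalgebra ℂ (X → ℂ)} {U : Set X} {x z : X → Mat m} (hxA : EntriesIn A x)
    (hzA : EntriesIn A z) (hdA : (fun v => (adOnMatrix π (x v)).det⁻¹) ∈ A)
    (hx : ∀ v ∈ U, x v ∈ regularSet H n) (hz : ∀ v ∈ U, z v ∈ n) (k : ℕ) :
    ∃ g y : X → Mat m, EntriesIn A g ∧ EntriesIn A y ∧ ∀ v ∈ U,
      (∃ γ ∈ expGroup n, (γ : Mat m) = g v) ∧ y v ∈ n ⊓ F (k + 1) ∧
      g v * (x v + y v) = (x v + z v) * g v := by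
  induction k with
  | zero =>
    refine ⟨fun _ => 1, z, .const 1, hzA, fun v hv => ⟨⟨1, one_mem _, rfl⟩, ?_, ?_⟩⟩
    · exact ⟨hz v hv, hS.le_one (hz v hv)⟩
    · rw [one_mul, mul_one]
  | succ k ih =>
    obtain ⟨g, y, hg, hy, hgy⟩ := ih
    -- The correction `w` solves `[x, w] = y`; conjugating `x + y` by `e^w` gives the next error,
    -- and `g` absorbs `e^(-w)` on the right.
    have hwA : EntriesIn A fun v => adOnInv π (x v) (y v) :=
      .linearMap_apply (fun a => hxA.adOnInv π hdA a) hy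
    refine ⟨fun v => g v * texp c (-adOnInv π (x v) (y v)),
      fun v => texp c (adOnInv π (x v) (y v)) * (x v + y v) * texp c (-adOnInv π (x v) (y v)) - x v,
      hg.mul (hwA.neg.texp c), (((hwA.texp c).mul (hxA.add hy)).mul (hwA.neg.texp c)).sub hxA,
      fun v hv => ?_⟩
    obtain ⟨⟨γ, hγ, hγg⟩, hyv, hconj⟩ := hgy v hv
    obtain ⟨hw, hxw⟩ := hS.adOnInv_mem hP (hx v hv) hyv.1
    have hwF := hS.adOnInv_mem_filtration hP (hx v hv) hyv.1 hyv.2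
    set w := adOnInv π (x v) (y v)
    have hwc := hS.pow_eq_zero_of_mem hw
    refine ⟨⟨γ * hS.expUnit (n.neg_mem hw), mul_mem hγ (hS.expUnit_mem _), ?_⟩, ?_, ?_⟩
    · rw [Units.val_mul, hγg]; rfl
    · refine texp_conj_add_sub_mem hwc (W := n ⊓ F (k + 1 + 1)) (fun u hu => ?_) ?_ ?_
      · exact ⟨hS.lie_mem _ (hS.n_le hw) _ hu.1, hS.lie_filtration_mem _ _ (hS.n_le hw) _ hu.2⟩
      · rw [← lie_skew, hxw]
      · refine ⟨hS.lie_mem _ (hS.n_le hw) _ hyv.1, ?_⟩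
        rw [LieRing.of_associative_ring_bracket]
        -- Both `w` and `y` have degree `k + 1`, so their products have degree `2k + 2`, which is at
        -- least `k + 2`.
        exact sub_mem (hS.antitone (by omega) (hS.filtration_mul_mem _ _ _ hwF _ hyv.2))
          (hS.antitone (by omega) (hS.filtration_mul_mem _ _ _ hyv.2 _ hwF))
    · rw [add_sub_cancel]
      calc g v * texp c (-w) * (texp c w * (x v + y v) * texp c (-w))
          = g v * (texp c (-w) * texp c w) * (x v + y v) * texp c (-w) := by
            simp only [mul_assoc]
        _ = (x v + z v) * (g v * texp c (-w)) := by
            rw [texp_neg_mul_texp hwc, mul_one, hconj, mul_assoc]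

/-- After `c` corrections the error lies beyond the end of the filtration. Keeping `A` arbitrary
serves two uses: polynomial functions with `x` constant, and regular functions with `x` varying. -/
lemma exists_conj (hS : FilteredSplitting H n B c F) (hP : SplitProjections H n p π)
    {X : Type*} {A : Subalgebra ℂ (X → ℂ)} {U : Set X} {x z : X → Mat m} (hxA : EntriesIn A x)
    (hzA : EntriesIn A z) (hdA : (fun v => (adOnMatrix π (x v)).det⁻¹) ∈ A)
    (hx : ∀ v ∈ U, x v ∈ regularSet H n) (hz : ∀ v ∈ U, z v ∈ n) :
    ∃ g : X → Mat m, EntriesIn A g ∧ ∀ v ∈ U,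
      (∃ γ ∈ expGroup n, (γ : Mat m) = g v) ∧ g v * x v = (x v + z v) * g v := by
  obtain ⟨g, y, hg, hy, h⟩ := hS.exists_approx_conj hP hxA hzA hdA hx hz c
  refine ⟨g, hg, fun v hv => ⟨(h v hv).1, ?_⟩⟩
  obtain ⟨-, h1, h2⟩ := h v hv
  have h3 : y v = 0 := by
    have := hS.antitone (Nat.le_succ c) h1.2
    rwa [hS.eq_bot, Submodule.mem_bot] at this
  rwa [h3, add_zero] at h2

end FilteredSplitting

/-- A filtered splitting in which regular elements exist and have trivial stabilizers. -/
structure FreeSplitting {m : ℕ} (H n B : Submodule ℂ (Mat m)) (c : ℕ)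
    (F : ℕ → Submodule ℂ (Mat m)) (p π : Mat m →ₗ[ℂ] Mat m) : Prop extends
    FilteredSplitting H n B c F, SplitProjections H n p π where
  eq_one_of_commute : ∀ g ∈ expGroup n, ∀ x ∈ regularSet H n,
    (g : Mat m) * x = x * (g : Mat m) → g = 1
  nonempty : (regularSet H n).Nonempty

/-! ### Uniqueness of the conjugating element and its regular or polynomial dependence on the data.
-/

namespace FreeSplitting

variable {m : ℕ} {H n B : Submodule ℂ (Mat m)} {c : ℕ} {F : ℕ → Submodule ℂ (Mat m)}
  {p π : Mat m →ₗ[ℂ] Mat m}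

lemma fst_add_snd (hS : FreeSplitting H n B c F p π) {y : Mat m} (hy : y ∈ B) : p y + π y = y :=
  hS.toFilteredSplitting.fst_add_snd hS.toSplitProjections hy

lemma fst_conj (hS : FreeSplitting H n B c F p π) {g : GL (Fin m) ℂ} (hg : g ∈ expGroup n)
    {x : Mat m} (hx : x ∈ H) : p ((g : Mat m) * x * (g : Mat m)⁻¹) = x := by
  have h := hS.fst_eq_zero _ (hS.conj_sub_mem hg (hS.h_le hx))
  rwa [map_sub, hS.fst_of_mem x hx, sub_eq_zero] at h

lemma eq_of_conj_eq (hS : FreeSplitting H n B c F p π) {g γ : GL (Fin m) ℂ}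
    (hg : g ∈ expGroup n) (hγ : γ ∈ expGroup n) {x : Mat m} (hx : x ∈ regularSet H n) {y : Mat m}
    (h1 : (g : Mat m) * x = y * (g : Mat m)) (h2 : (γ : Mat m) * x = y * (γ : Mat m)) : g = γ := by
  have h : γ⁻¹ * g = 1 := by
    refine hS.eq_one_of_commute _ (mul_mem (inv_mem hγ) hg) x hx ?_
    rw [Units.val_mul, mul_assoc, h1, ← mul_assoc, ← mul_assoc]
    congr 1
    rw [← Units.mul_left_inj γ, mul_assoc, mul_assoc, Units.inv_mul, mul_one, ← h2, ← mul_assoc,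
      Units.inv_mul, one_mul]
  exact (inv_mul_eq_one.mp h).symm

lemma mul_inv_cancel_of (g : GL (Fin m) ℂ) : (g : Mat m) * (g : Mat m)⁻¹ = 1 := by
  rw [← Matrix.coe_units_inv, Units.mul_inv]

lemma inv_mul_cancel_of (g : GL (Fin m) ℂ) : (g : Mat m)⁻¹ * (g : Mat m) = 1 := by
  rw [← Matrix.coe_units_inv, Units.inv_mul]

lemma conj_eq_iff (g : GL (Fin m) ℂ) (x y : Mat m) :
    (g : Mat m) * x * (g : Mat m)⁻¹ = y ↔ (g : Mat m) * x = y * (g : Mat m) := by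
  constructor
  · rintro rfl
    rw [mul_assoc, inv_mul_cancel_of, mul_one]
  · intro h
    rw [h, mul_assoc, mul_inv_cancel_of, mul_one]

/-- The elements of `B` whose component in `H` is regular. -/
def _root_.AdjointAction.regularTarget (H n B : Submodule ℂ (Mat m)) (p : Mat m →ₗ[ℂ] Mat m) :
    Set (Mat m) :=
  {y | y ∈ B ∧ p y ∈ regularSet H n}

/-- The inverse of the action map has regular entries. -/
lemma exists_regular_inverse (hS : FreeSplitting H n B c F p π) :
    ∃ G : Mat m → Mat m, EntriesIn (regularFun (regularTarget H n B p)) G ∧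
      ∀ y ∈ regularTarget H n B p,
        ∃ γ ∈ expGroup n, (γ : Mat m) = G y ∧ (γ : Mat m) * p y = y * (γ : Mat m) := by
  have hx : EntriesIn (regularFun (regularTarget H n B p)) (fun y => p y) := fun i j =>
    polyFun_le_regularFun _ (entriesIn_polyFun_id.linearMap p i j)
  have hz : EntriesIn (regularFun (regularTarget H n B p)) (fun y => π y) := fun i j =>
    polyFun_le_regularFun _ (entriesIn_polyFun_id.linearMap π i j)
  have hd : (fun y => (adOnMatrix π (p y)).det⁻¹) ∈ regularFun (regularTarget H n B p) :=
    inv_mem_regularFun ((entriesIn_polyFun_id.linearMap p).adOnMatrix π).det_mem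
      fun u hu => (hS.adOn_injective_iff hS.toSplitProjections hu.2.1).mpr hu.2
  obtain ⟨G, hG, h⟩ := hS.exists_conj (U := regularTarget H n B p) hS.toSplitProjections hx hz hd
    (fun v hv => hv.2)
    fun v _ => hS.snd_mem v
  refine ⟨G, hG, fun y hy => ?_⟩
  obtain ⟨⟨γ, hγ, hγG⟩, h2⟩ := h y hy
  refine ⟨γ, hγ, hγG, ?_⟩
  rw [hγG, h2, hS.fst_add_snd hy.1]

/-- The orbit of a regular element is parametrized polynomially. -/
lemma exists_polynomial_param (hS : FreeSplitting H n B c F p π) {x : Mat m}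
    (hx : x ∈ regularSet H n) :
    ∃ P : Mat m → Mat m, EntriesIn (polyFun (Mat m)) P ∧ ∀ a,
        ∃ γ ∈ expGroup n, (γ : Mat m) = P a ∧ (γ : Mat m) * x = (x + π a) * (γ : Mat m) := by
  obtain ⟨G, hG, h⟩ := hS.exists_conj (A := polyFun (Mat m)) (U := Set.univ) (x := fun _ => x)
    hS.toSplitProjections (.const x) (entriesIn_polyFun_id.linearMap π)
    ((polyFun (Mat m)).algebraMap_mem _) (fun v _ => hx) fun v _ => hS.snd_mem v
  refine ⟨G, hG, fun a => ?_⟩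
  obtain ⟨⟨γ, hγ, hγG⟩, h2⟩ := h a trivial
  exact ⟨γ, hγ, hγG, by rw [hγG, h2]⟩

end FreeSplitting

section

variable {m : ℕ} {X : Type*} {A : Subalgebra ℂ (X → ℂ)}

lemma EntriesIn.dual_prod_mem {f g : X → Mat m} (hf : EntriesIn A f) (hg : EntriesIn A g)
    (l : Module.Dual ℂ (Mat m × Mat m)) : (fun x => l (f x, g x)) ∈ A := by
  convert A.add_mem (hf.dual_mem (l ∘ₗ LinearMap.inl ℂ _ _))
    (hg.dual_mem (l ∘ₗ LinearMap.inr ℂ _ _)) using 1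
  ext x
  simp [← map_add]

lemma entriesIn_polyFun_fst : EntriesIn (polyFun (Mat m × Mat m)) fun q => q.1 := fun i j =>
  dual_mem_polyFun (Matrix.entryLinearMap ℂ ℂ i j ∘ₗ LinearMap.fst ℂ (Mat m) (Mat m))

lemma entriesIn_polyFun_snd : EntriesIn (polyFun (Mat m × Mat m)) fun q => q.2 := fun i j =>
  dual_mem_polyFun (Matrix.entryLinearMap ℂ ℂ i j ∘ₗ LinearMap.snd ℂ (Mat m) (Mat m))

lemma EntriesIn.comp {f : X → Mat m} {P : Mat m → Mat m} (hP : EntriesIn (polyFun (Mat m)) P)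
    (hf : EntriesIn A f) : EntriesIn A fun x => P (f x) := fun i j =>
  comp_mem_of_mem_polyFun (fun l => hf.dual_mem l) (hP i j)

/-- An image of an affine space under a polynomial map which is a zero set is an irreducible
variety. -/
lemma isAffineVariety_of_polynomial_image {V W : Type*} [AddCommGroup V] [Module ℂ V]
    [AddCommGroup W] [Module ℂ W] {Y : Set W} {S : Set (W → ℂ)} (hS : S ⊆ polyFun W)
    (hY : Y = {w | ∀ f ∈ S, f w = 0}) {φ : V → W}
    (hφ : ∀ l : Module.Dual ℂ W, (fun v => l (φ v)) ∈ polyFun V) (hφY : Set.range φ = Y) :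
    IsAffineVariety Y := by
  refine ⟨⟨S, hS, hY⟩, hφY ▸ Set.range_nonempty φ, fun f hf g hg h => ?_⟩
  rw [← hφY] at h ⊢
  simp only [Set.forall_mem_range] at h ⊢
  exact eq_zero_or_eq_zero_of_polyFun (comp_mem_of_mem_polyFun hφ hf)
    (comp_mem_of_mem_polyFun hφ hg) h

end

namespace FreeSplitting

variable {m : ℕ} {H n B : Submodule ℂ (Mat m)} {c : ℕ} {F : ℕ → Submodule ℂ (Mat m)}
  {p π : Mat m →ₗ[ℂ] Mat m}

/-- The displacement of a regular element determines the group element polynomially. -/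
lemma param_displacement (hS : FreeSplitting H n B c F p π) {x : Mat m}
    (hx : x ∈ regularSet H n) {P : Mat m → Mat m} (hP : ∀ a, ∃ γ ∈ expGroup n,
      (γ : Mat m) = P a ∧ (γ : Mat m) * x = (x + π a) * (γ : Mat m))
    {g : GL (Fin m) ℂ} (hg : g ∈ expGroup n) :
    P ((g : Mat m) * x * (g : Mat m)⁻¹ - x) = (g : Mat m) := by
  obtain ⟨γ, hγ, h1, h2⟩ := hP ((g : Mat m) * x * (g : Mat m)⁻¹ - x)
  rw [hS.snd_of_mem _ (hS.conj_sub_mem hg (hS.h_le hx.1)), add_sub_cancel] at h2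
  rw [← h1, hS.eq_of_conj_eq hγ hg hx h2 ((conj_eq_iff g _ _).mp rfl)]

/-- The product of `expGroup n` and `H`, as a set of pairs of matrices. -/
def _root_.AdjointAction.actionSource (H n : Submodule ℂ (Mat m)) : Set (Mat m × Mat m) :=
  {q | (∃ g ∈ expGroup n, (g : Mat m) = q.1) ∧ q.2 ∈ H}

/-- The group is cut out by `P (D a) = a`, where `D` is the displacement of `x` with the inverse
replaced by the geometric series, so that it is polynomial on all matrices. A solution `a` is a
value of `P`, and all values of `P` lie in the group. Irreducibility follows from the
parametrization by an affine space. -/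
lemma isAffineVariety_actionSource (hS : FreeSplitting H n B c F p π) :
    IsAffineVariety (actionSource H n) := by
  obtain ⟨x, hx⟩ := hS.nonempty
  obtain ⟨P, hPA, hP⟩ := hS.exists_polynomial_param hx
  let D : Mat m → Mat m := fun g => g * x * unipotentInv c g - x
  have hD : EntriesIn (polyFun (Mat m × Mat m)) fun q => P (D q.1) - q.1 := by
    refine EntriesIn.sub (hPA.comp (f := fun q : Mat m × Mat m => D q.1) ?_) entriesIn_polyFun_fst
    exact ((entriesIn_polyFun_fst.mul (.const x)).mul (entriesIn_polyFun_fst.unipotentInv c)).sub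
      (.const x)
  have hp : EntriesIn (polyFun (Mat m × Mat m)) fun q => p q.2 - q.2 :=
    (entriesIn_polyFun_snd.linearMap p).sub entriesIn_polyFun_snd
  have hgP : ∀ g ∈ expGroup n, P (D (g : Mat m)) = (g : Mat m) := fun g hg => by
    have h := hS.param_displacement hx hP hg
    rwa [hS.inv_eq hg] at h
  let S : Set (Mat m × Mat m → ℂ) := {f | ∃ i j, (f = fun q => (P (D q.1) - q.1) i j) ∨
    f = fun q => (p q.2 - q.2) i j}
  refine isAffineVariety_of_polynomial_image (V := Mat m × Mat m) (S := S)
    (φ := fun q => (P q.1, p q.2)) ?_ ?_ ?_ ?_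
  · rintro f ⟨i, j, rfl | rfl⟩
    · exact hD i j
    · exact hp i j
  · ext ⟨a, b⟩
    constructor
    · rintro ⟨⟨g, hg, rfl : (g : Mat m) = a⟩, hb⟩ f ⟨i, j, rfl | rfl⟩
      · simp [hgP g hg]
      · simp [hS.fst_of_mem b hb]
    · intro h
      have h1 : P (D a) - a = 0 := by
        ext i j
        exact h _ ⟨i, j, .inl rfl⟩
      have h2 : p b - b = 0 := by
        ext i j
        exact h _ ⟨i, j, .inr rfl⟩
      obtain ⟨γ, hγ, h3, -⟩ := hP (D a)
      exact ⟨⟨γ, hγ, h3.trans (sub_eq_zero.mp h1)⟩, sub_eq_zero.mp h2 ▸ hS.fst_mem b⟩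
  · exact fun l => EntriesIn.dual_prod_mem (hPA.comp entriesIn_polyFun_fst)
      (entriesIn_polyFun_snd.linearMap p) l
  · ext ⟨a, b⟩
    constructor
    · rintro ⟨q, hq⟩
      obtain ⟨γ, hγ, h3, -⟩ := hP q.1
      rw [← hq]
      exact ⟨⟨γ, hγ, h3⟩, hS.fst_mem _⟩
    · rintro ⟨⟨g, hg, rfl : (g : Mat m) = a⟩, hb⟩
      exact ⟨(D g, b), by simp [hgP g hg, hS.fst_of_mem b hb]⟩

lemma isAffineVariety_submodule (B : Submodule ℂ (Mat m)) : IsAffineVariety (B : Set (Mat m)) := by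
  obtain ⟨q, h1, h2, -⟩ := exists_projection (S := B) (T := ⊥) disjoint_bot_right
  have hq := entriesIn_polyFun_id.linearMap q
  refine isAffineVariety_of_polynomial_image (V := Mat m)
    (S := {f | ∃ i j, f = fun a => (q a - a) i j}) (φ := q) ?_ ?_ (fun l => hq.dual_mem l) ?_
  · rintro f ⟨i, j, rfl⟩
    exact (hq.sub entriesIn_polyFun_id) i j
  · ext a
    constructor
    · rintro ha f ⟨i, j, rfl⟩
      simp [h2 a ha]
    · intro h
      have h3 : q a - a = 0 := by
        ext i j
        exact h _ ⟨i, j, rfl⟩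
      rw [← sub_eq_zero.mp h3]
      exact h1 a
  · ext a
    exact ⟨fun ⟨b, hb⟩ => hb ▸ h1 b, fun ha => ⟨a, h2 a ha⟩⟩

lemma conj_mem_regularTarget (hS : FreeSplitting H n B c F p π) {g : GL (Fin m) ℂ}
    (hg : g ∈ expGroup n) {x : Mat m} (hx : x ∈ regularSet H n) :
    (g : Mat m) * x * (g : Mat m)⁻¹ ∈ regularTarget H n B p :=
  ⟨hS.conj_mem hg (hS.h_le hx.1), by rwa [hS.fst_conj hg hx.1]⟩

/-- The action map is a birational equivalence. -/
theorem isBirationalEquivalence (hS : FreeSplitting H n B c F p π) :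
    IsBirationalEquivalence (actionSource H n) (B : Set (Mat m))
      (fun q => q.1 * q.2 * q.1⁻¹) := by
  obtain ⟨G, hG, hGy⟩ := hS.exists_regular_inverse
  have hpoly : EntriesIn (polyFun (Mat m × Mat m)) fun q => q.1 * q.2 * unipotentInv c q.1 :=
    (entriesIn_polyFun_fst.mul entriesIn_polyFun_snd).mul (entriesIn_polyFun_fst.unipotentInv c)
  have hU : ∀ q ∈ actionSource H n, q.2 ∈ regularSet H n ↔ (adOnMatrix π q.2).det ≠ 0 :=
    fun q hq => (hS.adOn_injective_iff hS.toSplitProjections hq.2).symm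
  have hmaps : Set.MapsTo (fun q : Mat m × Mat m => q.1 * q.2 * q.1⁻¹)
      {q | q ∈ actionSource H n ∧ q.2 ∈ regularSet H n} (regularTarget H n B p) := by
    rintro ⟨_, b⟩ ⟨⟨⟨g, hg, rfl⟩, -⟩, hb⟩
    exact hS.conj_mem_regularTarget hg hb
  have hmaps' : Set.MapsTo (fun y => (G y, p y)) (regularTarget H n B p)
      {q | q ∈ actionSource H n ∧ q.2 ∈ regularSet H n} := by
    intro y hy
    obtain ⟨γ, hγ, h1, -⟩ := hGy y hy
    exact ⟨⟨⟨γ, hγ, h1⟩, hy.2.1⟩, hy.2⟩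
  have hinv : Set.InvOn (fun y => (G y, p y)) (fun q : Mat m × Mat m => q.1 * q.2 * q.1⁻¹)
      {q | q ∈ actionSource H n ∧ q.2 ∈ regularSet H n} (regularTarget H n B p) := by
    constructor
    · rintro ⟨_, b⟩ ⟨⟨⟨g, hg, rfl⟩, -⟩, hb⟩
      obtain ⟨γ, hγ, h1, h2⟩ := hGy _ (hS.conj_mem_regularTarget hg hb)
      have h3 := hS.fst_conj hg hb.1
      rw [h3] at h2
      refine Prod.ext ?_ h3
      change G ((g : Mat m) * b * (g : Mat m)⁻¹) = g
      rw [← h1, hS.eq_of_conj_eq hγ hg hb h2 ((conj_eq_iff g _ _).mp rfl)]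
    · intro y hy
      obtain ⟨γ, hγ, h1, h2⟩ := hGy y hy
      change G y * p y * (G y)⁻¹ = y
      rw [← h1, conj_eq_iff, h2]
  obtain ⟨x, hx⟩ := hS.nonempty
  refine ⟨hS.isAffineVariety_actionSource, isAffineVariety_submodule B, ?_, ?_,
    {q | q ∈ actionSource H n ∧ q.2 ∈ regularSet H n}, regularTarget H n B p, ?_, ?_, ?_, ?_,
    Set.InvOn.bijOn hinv hmaps hmaps', fun y => (G y, p y), hinv, ?_⟩
  · rintro ⟨_, b⟩ ⟨⟨g, hg, rfl⟩, hb⟩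
    exact hS.conj_mem hg (hS.h_le hb)
  · intro l
    refine regularFun_congr (polyFun_le_regularFun _ (hpoly.dual_mem l)) ?_
    rintro ⟨_, b⟩ ⟨⟨g, hg, rfl⟩, hb⟩
    simp only [hS.inv_eq hg]
  · exact ⟨(1, x), ⟨⟨1, one_mem _, rfl⟩, hx.1⟩, hx⟩
  · exact ⟨x, hS.h_le hx.1, by rwa [hS.fst_of_mem x hx.1]⟩
  · refine ⟨{fun q => (adOnMatrix π q.2).det}, ?_, ?_⟩
    · rw [Set.singleton_subset_iff]
      exact (entriesIn_polyFun_snd.adOnMatrix π).det_mem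
    · ext q
      simp only [Set.mem_ofPred_eq, Set.mem_singleton_iff, exists_eq_left]
      exact and_congr_right fun hq => hU q hq
  · refine ⟨{fun y => (adOnMatrix π (p y)).det}, ?_, ?_⟩
    · rw [Set.singleton_subset_iff]
      exact ((entriesIn_polyFun_id.linearMap p).adOnMatrix π).det_mem
    · ext y
      simp only [Set.mem_ofPred_eq, Set.mem_singleton_iff, exists_eq_left]
      exact and_congr_right fun _ =>
        (hS.adOn_injective_iff hS.toSplitProjections (hS.fst_mem y)).symm
  · exact fun l => hG.dual_prod_mem
      (fun i j => polyFun_le_regularFun _ (entriesIn_polyFun_id.linearMap p i j)) l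

end FreeSplitting

/-! ### Passage from matrices to normed coordinate spaces. -/

section Coordinates

variable {m : ℕ}

/-- `toMat` as a linear map. -/
def toMatLin (S : Submodule ℂ (Mat m)) : coordSpace S →ₗ[ℂ] Mat m :=
  (Matrix.ofLinearEquiv ℂ).toLinearMap ∘ₗ (coordSpace S).subtype

lemma toMat_mem {S : Submodule ℂ (Mat m)} (x : coordSpace S) : toMat x ∈ S := by
  obtain ⟨_, a, ha, rfl⟩ := x
  exact ha

lemma toMat_injective {S : Submodule ℂ (Mat m)} :
    Function.Injective (toMat : coordSpace S → Mat m) := fun _ _ h => Subtype.ext h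

lemma exists_retraction (S : Submodule ℂ (Mat m)) :
    ∃ r : Coord m →L[ℂ] coordSpace S, ∀ a (_ : a ∈ S), toMat (r (Matrix.of.symm a)) = a := by
  obtain ⟨r, hr⟩ := LinearMap.exists_leftInverse_of_injective (coordSpace S).subtype
    (by simp)
  refine ⟨LinearMap.toContinuousLinearMap r, fun a ha => ?_⟩
  have h : Matrix.of.symm a ∈ coordSpace S := ⟨a, ha, rfl⟩
  have := LinearMap.congr_fun hr ⟨_, h⟩
  have h2 : r (Matrix.of.symm a) = ⟨_, h⟩ := this
  change toMat (r (Matrix.of.symm a)) = a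
  rw [h2]
  rfl

/-- The projection of the space of matrices onto a subspace, in coordinates. -/
def retraction (S : Submodule ℂ (Mat m)) : Coord m →L[ℂ] coordSpace S :=
  (exists_retraction S).choose

lemma toMat_retraction {S : Submodule ℂ (Mat m)} {a : Mat m} (ha : a ∈ S) :
    toMat (retraction S (Matrix.of.symm a)) = a := (exists_retraction S).choose_spec a ha

variable {E : Type*} [NormedAddCommGroup E] [NormedSpace ℂ E] [FiniteDimensional ℂ E]

lemma EntriesIn.contDiffOn {U : Set E} {f : E → Mat m} (hf : EntriesIn (regularFun U) f) :
    ContDiffOn ℂ ω (fun v => (Matrix.of.symm (f v) : Coord m)) U :=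
  contDiffOn_pi.mpr fun i => contDiffOn_pi.mpr fun j => contDiffOn_of_mem_regularFun (hf i j)

lemma EntriesIn.contDiff {f : E → Mat m} (hf : EntriesIn (polyFun E) f) :
    ContDiff ℂ ω (fun v => (Matrix.of.symm (f v) : Coord m)) :=
  contDiff_pi.mpr fun i => contDiff_pi.mpr fun j => contDiff_of_mem_polyFun (hf i j)

lemma entriesIn_polyFun_linear {V : Type*} [AddCommGroup V] [Module ℂ V] (φ : V →ₗ[ℂ] Mat m) :
    EntriesIn (polyFun V) fun v => φ v :=
  fun i j => dual_mem_polyFun (Matrix.entryLinearMap ℂ ℂ i j ∘ₗ φ)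

/-- The topology of a unit group also records the inverse; it agrees with the subspace topology
because inversion is continuous, by the adjugate formula. -/
lemma isEmbedding_inclusion (N : Subgroup (GL (Fin m) ℂ)) :
    Topology.IsEmbedding (inclusion N) := by
  have h : Topology.IsEmbedding (Units.val : GL (Fin m) ℂ → Mat m) := by
    refine Units.isEmbedding_val_mk' (f := fun A : Mat m => A.det⁻¹ • A.adjugate) ?_ ?_
    · have h1 : ContinuousOn (fun A : Mat m => A.det⁻¹) {A | IsUnit A} :=
        (continuous_id.matrix_det).continuousOn.inv₀
          fun A hA => ((Matrix.isUnit_iff_isUnit_det A).mp hA).ne_zero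
      exact h1.smul (continuous_id.matrix_adjugate).continuousOn
    · intro u
      rw [Matrix.coe_units_inv, Matrix.inv_def, Ring.inverse_eq_inv']
  exact h.comp Topology.IsEmbedding.subtypeVal

end Coordinates

/-- A global chart makes a space a manifold. -/
lemma exists_chartedSpace {M E : Type*} [TopologicalSpace M] [NormedAddCommGroup E]
    [NormedSpace ℂ E] (e : M ≃ₜ E) : ∃ _ : ChartedSpace E M, IsManifold 𝓘(ℂ, E) ω M ∧
      ContMDiff 𝓘(ℂ, E) 𝓘(ℂ, E) ω e ∧ ContMDiff 𝓘(ℂ, E) 𝓘(ℂ, E) ω e.symm := by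
  let charts := e.toOpenPartialHomeomorph.singletonChartedSpace rfl
  have hM : IsManifold 𝓘(ℂ, E) ω M := e.toOpenPartialHomeomorph.isManifold_singleton rfl
  have hmem : e.toOpenPartialHomeomorph ∈ IsManifold.maximalAtlas 𝓘(ℂ, E) ω M :=
    StructureGroupoid.subset_maximalAtlas _ rfl
  exact ⟨charts, hM, contMDiffOn_univ.mp (contMDiffOn_of_mem_maximalAtlas hmem),
    contMDiffOn_univ.mp (contMDiffOn_symm_of_mem_maximalAtlas hmem)⟩

/-! ### The global chart of the unipotent group and the biholomorphic action map. -/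

namespace FreeSplitting

variable {m : ℕ} {H n B : Submodule ℂ (Mat m)} {c : ℕ} {F : ℕ → Submodule ℂ (Mat m)}
  {p π : Mat m →ₗ[ℂ] Mat m}

/-- A global chart of `expGroup n`, given by the orbit of a regular element: it extends to a
holomorphic map on the space of matrices, and its inverse is a polynomial map. -/
lemma exists_homeomorph (hS : FreeSplitting H n B c F p π) :
    ∃ (e : expGroup n ≃ₜ coordSpace n) (D : Coord m → coordSpace n) (P : coordSpace n → Coord m),
      ContDiff ℂ ω D ∧ ContDiff ℂ ω P ∧ (∀ g, e g = D (inclusion _ g)) ∧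
      ∀ z, inclusion _ (e.symm z) = P z := by
  obtain ⟨x, hx⟩ := hS.nonempty
  obtain ⟨P, hPA, hP⟩ := hS.exists_polynomial_param hx
  let D : Coord m → coordSpace n := fun a =>
    retraction n (Matrix.of.symm (Matrix.of a * x * unipotentInv c (Matrix.of a) - x))
  have hD : ContDiff ℂ ω D := by
    have h := entriesIn_polyFun_linear (Matrix.ofLinearEquiv (m := Fin m) (n := Fin m) (α := ℂ)
      ℂ).toLinearMap
    exact (retraction n).contDiff.comp
      (((h.mul (.const x)).mul (h.unipotentInv c)).sub (.const x)).contDiff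
  have hP' : ContDiff ℂ ω fun z : coordSpace n => (Matrix.of.symm (P (toMat z)) : Coord m) :=
    (hPA.comp (entriesIn_polyFun_linear (toMatLin n))).contDiff
  have hγ : ∀ z : coordSpace n, ∃ γ : expGroup n, ((γ : GL (Fin m) ℂ) : Mat m) = P (toMat z) ∧
      ((γ : GL (Fin m) ℂ) : Mat m) * x = (x + toMat z) * ((γ : GL (Fin m) ℂ) : Mat m) := by
    intro z
    obtain ⟨γ, h1, h2, h3⟩ := hP (toMat z)
    exact ⟨⟨γ, h1⟩, h2, by rwa [hS.snd_of_mem _ (toMat_mem z)] at h3⟩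
  choose Γ hΓ1 hΓ2 using hγ
  have hDg : ∀ g : expGroup n, toMat (D (inclusion _ g)) =
      ((g : GL (Fin m) ℂ) : Mat m) * x * ((g : GL (Fin m) ℂ) : Mat m)⁻¹ - x := by
    intro g
    rw [← toMat_retraction (hS.conj_sub_mem g.2 (hS.h_le hx.1)), hS.inv_eq g.2]
    rfl
  refine ⟨⟨⟨fun g => D (inclusion _ g), Γ, fun g => ?_, fun z => ?_⟩, ?_, ?_⟩, D, _, hD, hP',
    fun _ => rfl, fun z => ?_⟩
  · apply Subtype.ext
    apply Units.ext
    rw [hΓ1, hDg, hS.param_displacement hx hP g.2]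
  · apply toMat_injective
    rw [hDg, (conj_eq_iff _ _ _).mpr (hΓ2 z), add_sub_cancel_left]
  · exact hD.continuous.comp (isEmbedding_inclusion _).continuous
  · rw [(isEmbedding_inclusion _).continuous_iff]
    exact hP'.continuous.congr fun z => (congrArg Matrix.of.symm (hΓ1 z)).symm
  · exact congrArg Matrix.of.symm (hΓ1 z)

/-- The action map is an isomorphism of complex manifolds. -/
theorem exists_manifold_isomorphism (hS : FreeSplitting H n B c F p π) :
    ∃ _ : ChartedSpace (coordSpace n) (expGroup n),
      IsEmbeddedSubmanifold (coordSpace n) (expGroup n) ∧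
      ∃ Φ : OpenPartialHomeomorph (expGroup n × coordSpace H) (coordSpace B),
        Φ.source = {q | toMat q.2 ∈ regularSet H n} ∧
        Φ.target = {y | toMat y ∈ regularTarget H n B p} ∧
        (∀ q ∈ Φ.source, toMat (Φ q) = ((q.1 : GL (Fin m) ℂ) : Mat m) * toMat q.2 *
          ((q.1 : GL (Fin m) ℂ) : Mat m)⁻¹) ∧
        ContMDiffOn (𝓘(ℂ, coordSpace n).prod 𝓘(ℂ, coordSpace H)) 𝓘(ℂ, coordSpace B) ω
          Φ Φ.source ∧
        ContMDiffOn 𝓘(ℂ, coordSpace B) (𝓘(ℂ, coordSpace n).prod 𝓘(ℂ, coordSpace H)) ω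
          Φ.symm Φ.target := by
  obtain ⟨e, D, P, hD, hP, heD, heP⟩ := hS.exists_homeomorph
  obtain ⟨charts, hM, he, hesymm⟩ := exists_chartedSpace e
  have hincl : ContMDiff 𝓘(ℂ, coordSpace n) 𝓘(ℂ, Coord m) ω (inclusion (expGroup n)) := by
    refine (hP.contMDiff.comp he).congr fun g => ?_
    rw [Function.comp_apply, ← heP, e.symm_apply_apply]
  -- A holomorphic left inverse of the inclusion, defined on all matrices. It makes the derivative
  -- of the inclusion injective, and it turns holomorphic matrix-valued maps with values in the
  -- group into holomorphic maps to the manifold.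
  have hret : ContMDiff 𝓘(ℂ, Coord m) 𝓘(ℂ, coordSpace n) ω fun a => e.symm (D a) :=
    hesymm.comp hD.contMDiff
  refine ⟨charts, ⟨hM, isEmbedding_inclusion _, hincl, fun g => ?_⟩, ?_⟩
  · have h1 : (fun a => e.symm (D a)) ∘ inclusion (expGroup n) = id := by
      ext1 g
      rw [Function.comp_apply, ← heD, e.symm_apply_apply, id]
    have h2 := mfderiv_comp g ((hret.mdifferentiable (by simp)) _)
      ((hincl.mdifferentiable (by simp)) g)
    rw [h1, mfderiv_id] at h2
    intro v w hvw
    have h3 : ∀ u, mfderiv 𝓘(ℂ, Coord m) 𝓘(ℂ, coordSpace n) (fun a => e.symm (D a))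
        (inclusion (expGroup n) g) (mfderiv 𝓘(ℂ, coordSpace n) 𝓘(ℂ, Coord m)
        (inclusion (expGroup n)) g u) = u := fun u => (DFunLike.congr_fun h2 u).symm
    rw [← h3 v, ← h3 w, hvw]
  obtain ⟨G, hGA, hG⟩ := hS.exists_regular_inverse
  let act : Coord m × coordSpace H → coordSpace B := fun q =>
    retraction B (Matrix.of.symm (Matrix.of q.1 * toMat q.2 * unipotentInv c (Matrix.of q.1)))
  have hact : ContDiff ℂ ω act := by
    have h1 := entriesIn_polyFun_linear ((Matrix.ofLinearEquiv (m := Fin m) (n := Fin m) (α := ℂ)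
      ℂ).toLinearMap ∘ₗ LinearMap.fst ℂ (Coord m) (coordSpace H))
    have h2 := entriesIn_polyFun_linear (toMatLin H ∘ₗ LinearMap.snd ℂ (Coord m) (coordSpace H))
    exact (retraction B).contDiff.comp ((h1.mul h2).mul (h1.unipotentInv c)).contDiff
  have hact_apply : ∀ q : expGroup n × coordSpace H, toMat (act (inclusion _ q.1, q.2)) =
      ((q.1 : GL (Fin m) ℂ) : Mat m) * toMat q.2 * ((q.1 : GL (Fin m) ℂ) : Mat m)⁻¹ := by
    intro q
    rw [← toMat_retraction (hS.conj_mem q.1.2 (hS.h_le (toMat_mem q.2))), hS.inv_eq q.1.2]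
    rfl
  have hγ : ∀ y : coordSpace B, toMat y ∈ regularTarget H n B p → ∃ γ : expGroup n,
      ((γ : GL (Fin m) ℂ) : Mat m) = G (toMat y) ∧ ((γ : GL (Fin m) ℂ) : Mat m) * p (toMat y) =
      toMat y * ((γ : GL (Fin m) ℂ) : Mat m) := by
    intro y hy
    obtain ⟨γ, h1, h2, h3⟩ := hG _ hy
    exact ⟨⟨γ, h1⟩, h2, h3⟩
  choose! Γ hΓ1 hΓ2 using hγ
  have hGc : ContDiffOn ℂ ω (fun y : coordSpace B => (Matrix.of.symm (G (toMat y)) : Coord m))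
      {y | toMat y ∈ regularTarget H n B p} :=
    EntriesIn.contDiffOn fun i j =>
      comp_linearMap_mem_regularFun (toMatLin B) (fun y hy => hy) (hGA i j)
  let proj : coordSpace B → coordSpace H := fun y => retraction H (Matrix.of.symm (p (toMat y)))
  have hproj : ContDiff ℂ ω proj :=
    (retraction H).contDiff.comp (entriesIn_polyFun_linear (p ∘ₗ toMatLin B)).contDiff
  have hproj_apply : ∀ y, toMat (proj y) = p (toMat y) := fun y => toMat_retraction (hS.fst_mem _)
  have hΦ : ContMDiff (𝓘(ℂ, coordSpace n).prod 𝓘(ℂ, coordSpace H)) 𝓘(ℂ, coordSpace B) ω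
      fun q : expGroup n × coordSpace H => act (inclusion _ q.1, q.2) :=
    hact.contMDiff.comp ((hincl.comp contMDiff_fst).prodMk_space contMDiff_snd)
  have hΓ : ContMDiffOn 𝓘(ℂ, coordSpace B) 𝓘(ℂ, coordSpace n) ω Γ
      {y | toMat y ∈ regularTarget H n B p} := by
    -- On the target, `Γ` is the left inverse of the inclusion applied to the regular matrix-valued
    -- map `G`.
    refine (hret.comp_contMDiffOn hGc.contMDiffOn).congr fun y hy => ?_
    have h : (Matrix.of.symm (G (toMat y)) : Coord m) = inclusion _ (Γ y) :=
      congrArg Matrix.of.symm (hΓ1 y hy).symm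
    rw [Function.comp_apply, h, ← heD, e.symm_apply_apply]
  have hΨ : ContMDiffOn 𝓘(ℂ, coordSpace B) (𝓘(ℂ, coordSpace n).prod 𝓘(ℂ, coordSpace H)) ω
      (fun y => (Γ y, proj y)) {y | toMat y ∈ regularTarget H n B p} :=
    hΓ.prodMk hproj.contMDiff.contMDiffOn
  refine ⟨{
    toFun := fun q => act (inclusion _ q.1, q.2)
    invFun := fun y => (Γ y, proj y)
    source := {q | toMat q.2 ∈ regularSet H n}
    target := {y | toMat y ∈ regularTarget H n B p}
    map_source' := ?_
    map_target' := ?_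
    left_inv' := ?_
    right_inv' := ?_
    open_source := ?_
    open_target := ?_
    continuousOn_toFun := hΦ.continuous.continuousOn
    continuousOn_invFun := hΨ.continuousOn }, rfl, rfl, fun q _ => hact_apply q,
    hΦ.contMDiffOn, hΨ⟩
  · intro q hq
    rw [Set.mem_ofPred_eq, hact_apply]
    exact hS.conj_mem_regularTarget q.1.2 hq
  · intro y hy
    rw [Set.mem_ofPred_eq, hproj_apply]
    exact hy.2
  · intro q hq
    have h0 : toMat (act (inclusion _ q.1, q.2)) ∈ regularTarget H n B p := by
      rw [hact_apply]
      exact hS.conj_mem_regularTarget q.1.2 hq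
    have h1 : p (toMat (act (inclusion _ q.1, q.2))) = toMat q.2 := by
      rw [hact_apply]
      exact hS.fst_conj q.1.2 hq.1
    have h2 := hΓ2 _ h0
    rw [h1] at h2
    refine Prod.ext (Subtype.ext ?_) (toMat_injective ?_)
    · refine hS.eq_of_conj_eq (Γ _).2 q.1.2 hq h2 ?_
      rw [hact_apply]
      exact (conj_eq_iff _ _ _).mp rfl
    · rw [hproj_apply, h1]
  · intro y hy
    apply toMat_injective
    rw [hact_apply, conj_eq_iff, hproj_apply]
    exact hΓ2 y hy
  · have hc := (contDiff_of_mem_polyFun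
      ((entriesIn_polyFun_linear (toMatLin H)).adOnMatrix π).det_mem).continuous
    have : {q : expGroup n × coordSpace H | toMat q.2 ∈ regularSet H n} =
        (fun q : expGroup n × coordSpace H => (adOnMatrix π (toMatLin H q.2)).det) ⁻¹' {0}ᶜ := by
      ext q
      exact (hS.adOn_injective_iff hS.toSplitProjections (toMat_mem q.2)).symm
    rw [this]
    exact isOpen_compl_singleton.preimage (hc.comp continuous_snd)
  · have hc := (contDiff_of_mem_polyFun
      ((entriesIn_polyFun_linear (p ∘ₗ toMatLin B)).adOnMatrix π).det_mem).continuous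
    have : {y : coordSpace B | toMat y ∈ regularTarget H n B p} =
        (fun y : coordSpace B => (adOnMatrix π ((p ∘ₗ toMatLin B) y)).det) ⁻¹' {0}ᶜ := by
      ext y
      have h := hS.adOn_injective_iff hS.toSplitProjections (hS.fst_mem (toMat y))
      exact ⟨fun hy => h.mpr hy.2, fun hy => ⟨toMat_mem y, h.mp hy⟩⟩
    rw [this]
    exact isOpen_compl_singleton.preimage hc

end FreeSplitting

/-! ### Solvable Lie algebras -/

section Solvable

open LieModule LieAlgebra

/-- A consequence of Lie's theorem: the derived algebra of a solvable Lie algebra acts by nilpotent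
endomorphisms. -/
theorem isNilpotent_toEnd_of_mem_derivedSeries {K V : Type*} [LieRing K] [LieAlgebra ℂ K]
    [LieAlgebra.IsSolvable K] [AddCommGroup V] [Module ℂ V] [FiniteDimensional ℂ V]
    [LieRingModule K V] [LieModule ℂ K V] {x : K} (hx : x ∈ derivedSeries ℂ K 1) :
    IsNilpotent (toEnd ℂ K V x) := by
  induction hd : Module.finrank ℂ V using Nat.strong_induction_on generalizing V with
  | _ d ih =>
    rcases subsingleton_or_nontrivial V with hV | hV
    · exact ⟨0, Subsingleton.elim _ _⟩
    -- Lie's theorem gives a nonzero weight space `W`. A weight kills brackets, so `x` acts as zero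
    -- on `W`; by induction on the dimension it is nilpotent on `V ⧸ W`.
    obtain ⟨χ, hχ⟩ := exists_nontrivial_weightSpace_of_isSolvable ℂ K V
    obtain ⟨⟨v, hv⟩, hv0⟩ := exists_ne (0 : weightSpace V χ)
    have hv0' : v ≠ 0 := fun h => hv0 (Subtype.ext h)
    have hχx : χ x = 0 := by
      have h1 : (derivedSeries ℂ K 1).toSubmodule ≤ LinearMap.ker χ := by
        have h2 := coe_derivedSeries_one_eq ℂ K
        change (derivedSeries ℂ K 1).toSubmodule = _ at h2
        rw [h2, Submodule.span_le]
        rintro _ ⟨y, z, rfl⟩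
        have h3 : χ ⁅y, z⁆ • v = 0 := by
          rw [← (mem_weightSpace χ v).mp hv, lie_lie, (mem_weightSpace χ v).mp hv z,
            (mem_weightSpace χ v).mp hv y, lie_smul, lie_smul, (mem_weightSpace χ v).mp hv z,
            (mem_weightSpace χ v).mp hv y, smul_comm, sub_self]
        exact (smul_eq_zero.mp h3).resolve_right hv0'
      exact h1 hx
    let W : LieSubmodule ℂ K V := weightSpace V χ
    have hlt : Module.finrank ℂ (V ⧸ W) < d := by
      have h1 := Submodule.finrank_quotient_add_finrank W.toSubmodule
      have h2 : 0 < Module.finrank ℂ W := Module.finrank_pos_iff.mpr hχ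
      change Module.finrank ℂ (V ⧸ W.toSubmodule) < d
      change 0 < Module.finrank ℂ W.toSubmodule at h2
      omega
    obtain ⟨k, hk⟩ := ih _ hlt rfl (V := V ⧸ W)
    have hmk : ∀ j : ℕ, ∀ u : V, (LieSubmodule.Quotient.mk ((toEnd ℂ K V x ^ j) u) : V ⧸ W) =
        (toEnd ℂ K (V ⧸ W) x ^ j) (LieSubmodule.Quotient.mk u) := by
      intro j
      induction j with
      | zero => intro u; rfl
      | succ j ihj => intro u; rw [pow_succ, Module.End.mul_apply, ihj]; rfl
    refine ⟨k + 1, LinearMap.ext fun u => ?_⟩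
    have h1 : (toEnd ℂ K V x ^ k) u ∈ W := by
      refine (LieSubmodule.Quotient.mk_eq_zero (N := W)).mp ((hmk k u).trans ?_)
      rw [hk]
      rfl
    rw [pow_succ', Module.End.mul_apply, toEnd_apply_apply, (mem_weightSpace χ _).mp h1 x, hχx,
      zero_smul]
    rfl

/-- Once the derived series has entered `I`, it continues inside the derived series of `I`, which
terminates. -/
lemma isSolvable_of_derivedSeries_le {K : Type*} [LieRing K] [LieAlgebra ℂ K] (I : LieIdeal ℂ K)
    [LieAlgebra.IsSolvable I] {k : ℕ} (hk : derivedSeries ℂ K k ≤ I) :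
    LieAlgebra.IsSolvable K := by
  obtain ⟨l, hl⟩ := IsSolvable.solvable ℂ I
  rw [LieIdeal.derivedSeries_eq_bot_iff] at hl
  apply IsSolvable.mk (R := ℂ) (k := l + k)
  rw [derivedSeries_def, derivedSeriesOfIdeal_add, ← le_bot_iff, ← hl]
  exact derivedSeriesOfIdeal_mono hk l

variable {L : Type*} [LieRing L] [LieAlgebra ℂ L]

/-- The subalgebra spanned by a subalgebra `b` and a subspace `u`. -/
def supSubalgebra (b : LieSubalgebra ℂ L) (u : Submodule ℂ L)
    (hbu : ∀ x ∈ b, ∀ y ∈ u, ⁅x, y⁆ ∈ b.toSubmodule ⊔ u)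
    (huu : ∀ x ∈ u, ∀ y ∈ u, ⁅x, y⁆ ∈ b.toSubmodule ⊔ u) : LieSubalgebra ℂ L where
  toSubmodule := b.toSubmodule ⊔ u
  lie_mem' := by
    intro x y hx hy
    obtain ⟨x1, hx1, x2, hx2, rfl⟩ := Submodule.mem_sup.mp hx
    obtain ⟨y1, hy1, y2, hy2, rfl⟩ := Submodule.mem_sup.mp hy
    rw [add_lie, lie_add, lie_add]
    refine add_mem (add_mem (Submodule.mem_sup_left (b.lie_mem hx1 hy1)) (hbu _ hx1 _ hy2))
      (add_mem ?_ (huu _ hx2 _ hy2))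
    rw [← lie_skew]
    exact neg_mem (hbu _ hy1 _ hx2)

/-- An element normalizing a Borel subalgebra belongs to it. -/
lemma IsBorel.mem_of_normalizes {b : LieSubalgebra ℂ L} (hb : IsBorel b) {z : L}
    (hz : ∀ x ∈ b, ⁅z, x⁆ ∈ b) : z ∈ b := by
  have hz' : ∀ x ∈ b, ⁅x, z⁆ ∈ b := fun x hx => by
    rw [← lie_skew]
    exact neg_mem (hz x hx)
  -- Adjoining a normalizing `z` gives an algebra `K` with `[K, K] ⊆ b`, hence solvable; maximality
  -- forces `K ≤ b`.
  let K := supSubalgebra b (ℂ ∙ z)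
    (by
      rintro x hx y hy
      obtain ⟨t, rfl⟩ := Submodule.mem_span_singleton.mp hy
      rw [lie_smul]
      exact Submodule.mem_sup_left (b.smul_mem t (hz' x hx)))
    (by
      rintro x hx y hy
      obtain ⟨s, rfl⟩ := Submodule.mem_span_singleton.mp hx
      obtain ⟨t, rfl⟩ := Submodule.mem_span_singleton.mp hy
      rw [lie_smul, smul_lie, lie_self, smul_zero, smul_zero]
      exact zero_mem _)
  have hbK : b ≤ K := fun x hx => Submodule.mem_sup_left hx
  have hbracket : ∀ x ∈ K, ∀ y ∈ K, ⁅x, y⁆ ∈ b := by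
    intro x hx y hy
    obtain ⟨x1, hx1, x2, hx2, rfl⟩ := Submodule.mem_sup.mp hx
    obtain ⟨y1, hy1, y2, hy2, rfl⟩ := Submodule.mem_sup.mp hy
    obtain ⟨s, rfl⟩ := Submodule.mem_span_singleton.mp hx2
    obtain ⟨t, rfl⟩ := Submodule.mem_span_singleton.mp hy2
    rw [add_lie, lie_add, lie_add, lie_smul, lie_smul, smul_lie, smul_lie, lie_self, smul_zero,
      smul_zero, add_zero]
    exact add_mem (add_mem (b.lie_mem hx1 hy1) (b.smul_mem _ (hz' _ hx1)))
      (b.smul_mem _ (hz _ hy1))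
  let I : LieIdeal ℂ K := {
    b.toSubmodule.comap K.toSubmodule.subtype with
    lie_mem := fun {x y} _ => hbracket x x.2 y y.2 }
  have hbs : LieAlgebra.IsSolvable b := hb.prop
  have hI : LieAlgebra.IsSolvable I := by
    let f : I →ₗ⁅ℂ⁆ b := {
      toFun := fun x => ⟨x.1.1, x.2⟩
      map_add' := fun _ _ => rfl
      map_smul' := fun _ _ => rfl
      map_lie' := rfl }
    have hf : Function.Injective f := fun x y h =>
      Subtype.ext (Subtype.ext (congrArg (fun w : b => (w : L)) h))
    exact hf.lieAlgebra_isSolvable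
  have hK : LieAlgebra.IsSolvable K := by
    refine isSolvable_of_derivedSeries_le I (k := 1) ?_
    rw [derivedSeries_def, derivedSeriesOfIdeal_succ, derivedSeriesOfIdeal_zero,
      LieSubmodule.lie_le_iff]
    exact fun x _ y _ => hbracket x x.2 y y.2
  exact hb.le_of_ge hK hbK (Submodule.mem_sup_right (Submodule.mem_span_singleton_self z))

/-- An abelian subspace normalized by a Borel subalgebra is contained in it. -/
lemma IsBorel.le_of_abelian {b : LieSubalgebra ℂ L} (hb : IsBorel b) {u : Submodule ℂ L}
    (hbu : ∀ x ∈ b, ∀ y ∈ u, ⁅x, y⁆ ∈ u) (huu : ∀ x ∈ u, ∀ y ∈ u, ⁅x, y⁆ = 0) :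
    u ≤ b.toSubmodule := by
  let K := supSubalgebra b u (fun x hx y hy => Submodule.mem_sup_right (hbu x hx y hy))
    (fun x hx y hy => by rw [huu x hx y hy]; exact zero_mem _)
  have hbK : b ≤ K := fun x hx => Submodule.mem_sup_left hx
  let I : LieIdeal ℂ K := {
    u.comap K.toSubmodule.subtype with
    lie_mem := by
      rintro ⟨x, hx⟩ ⟨y, hy'⟩ (hy : y ∈ u)
      change ⁅x, y⁆ ∈ u
      obtain ⟨x1, hx1, x2, hx2, rfl⟩ := Submodule.mem_sup.mp hx
      rw [add_lie, huu _ hx2 _ hy, add_zero]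
      exact hbu _ hx1 _ hy }
  have hI : LieAlgebra.IsSolvable I := by
    have : IsLieAbelian I := ⟨fun x y => Subtype.ext (Subtype.ext (huu _ x.2 _ y.2))⟩
    infer_instance
  -- Modulo the abelian ideal `u`, the derived series of `b + u` is bounded by that of `b`, so it
  -- eventually falls into `u`.
  let T : ℕ → Submodule ℂ L := fun k =>
    (derivedSeries ℂ b k).toSubmodule.map b.toSubmodule.subtype ⊔ u
  have hder : ∀ k, (derivedSeries ℂ K k).toSubmodule ≤ (T k).comap K.toSubmodule.subtype := by
    intro k
    induction k with
    | zero =>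
      rintro ⟨x, hx⟩ -
      obtain ⟨x1, hx1, x2, hx2, rfl⟩ := Submodule.mem_sup.mp hx
      have h1 : x1 ∈ T 0 := Submodule.mem_sup_left ⟨⟨x1, hx1⟩, trivial, rfl⟩
      have h2 : x2 ∈ T 0 := Submodule.mem_sup_right hx2
      exact add_mem h1 h2
    | succ k ih =>
      rw [derivedSeries_def, derivedSeriesOfIdeal_succ, LieSubmodule.lieIdeal_oper_eq_linear_span',
        Submodule.span_le]
      rintro _ ⟨x, hx, y, hy, rfl⟩
      obtain ⟨_, ⟨(x1 : b), hx1, rfl⟩, x2, hx2, hxe⟩ := Submodule.mem_sup.mp (ih hx)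
      obtain ⟨_, ⟨(y1 : b), hy1, rfl⟩, y2, hy2, hye⟩ := Submodule.mem_sup.mp (ih hy)
      change ⁅(x : L), (y : L)⁆ ∈ T (k + 1)
      change (x1 : L) + x2 = (x : L) at hxe
      change (y1 : L) + y2 = (y : L) at hye
      rw [← hxe, ← hye, add_lie, lie_add, lie_add, huu _ hx2 _ hy2, add_zero]
      refine add_mem (add_mem (Submodule.mem_sup_left ⟨⁅x1, y1⁆, ?_, rfl⟩)
        (Submodule.mem_sup_right (hbu _ x1.2 _ hy2))) (Submodule.mem_sup_right ?_)
      · rw [derivedSeries_def, derivedSeriesOfIdeal_succ]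
        exact LieSubmodule.lie_mem_lie hx1 hy1
      · rw [← lie_skew]
        exact neg_mem (hbu _ y1.2 _ hx2)
  have hK : LieAlgebra.IsSolvable K := by
    have hbs : LieAlgebra.IsSolvable b := hb.prop
    obtain ⟨k, hk⟩ := IsSolvable.solvable ℂ b
    refine isSolvable_of_derivedSeries_le I (k := k) fun x hx => ?_
    have h := hder k hx
    change (x : L) ∈ T k at h
    simp only [T, hk] at h
    change (x : L) ∈ u
    simpa using h
  exact fun x hx => hb.le_of_ge hK hbK (Submodule.mem_sup_right hx)

end Solvable

/-! ### Structure of a Borel subalgebra containing a Cartan subalgebra. -/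

section Borel

open LieModule LieAlgebra

variable {L : Type*} [LieRing L] [LieAlgebra ℂ L]

lemma coe_ad_pow_ideal {K : Type*} [LieRing K] [LieAlgebra ℂ K] (I : LieIdeal ℂ K) (x : I) (k : ℕ)
    (y : I) : (((ad ℂ I x) ^ k) y : K) = ((ad ℂ K (x : K)) ^ k) (y : K) := by
  induction k generalizing y with
  | zero => rfl
  | succ k ih => rw [pow_succ, pow_succ, Module.End.mul_apply, Module.End.mul_apply, ih]; rfl

/-- The derived algebra of a subalgebra, as a subspace of the ambient Lie algebra. -/
def derivedSpace (b : LieSubalgebra ℂ L) : Submodule ℂ L :=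
  (derivedSeries ℂ b 1).toSubmodule.map b.toSubmodule.subtype

lemma derivedSpace_le (b : LieSubalgebra ℂ L) : derivedSpace b ≤ b.toSubmodule := by
  rintro _ ⟨x, -, rfl⟩
  exact x.2

lemma lie_mem_derivedSpace {b : LieSubalgebra ℂ L} {x y : L} (hx : x ∈ b) (hy : y ∈ b) : ⁅x, y⁆ ∈ derivedSpace b := by
  refine ⟨⁅(⟨x, hx⟩ : b), (⟨y, hy⟩ : b)⁆, ?_, rfl⟩
  rw [derivedSeries_def, derivedSeriesOfIdeal_succ, derivedSeriesOfIdeal_zero]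
  exact LieSubmodule.lie_mem_lie trivial trivial

lemma eq_zero_of_ad_eq_zero [LieAlgebra.IsSemisimple ℂ L] {x : L} (hx : ad ℂ L x = 0) : x = 0 := by
  have h := ad_ker_eq_bot_of_hasTrivialRadical ℂ L
  have : x ∈ (ad ℂ L).ker := hx
  rwa [h, LieSubmodule.mem_bot] at this

variable [FiniteDimensional ℂ L]

/-- Finitely many proper hyperplanes do not cover a complex vector space; all nonzero weights can be
avoided at once. -/
lemma exists_forall_positiveRoots_ne_zero (h b : LieSubalgebra ℂ L) [h.IsCartanSubalgebra] :
    ∃ x : h, ∀ α ∈ positiveRoots h b, α x ≠ 0 := by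
  obtain ⟨x, -, hx⟩ := Module.Dual.exists_forall_mem_ne_zero_of_forall_exists (ι :=
    {α : Weight ℂ h L // α.IsNonZero}) (⊤ : Submodule ℂ h) (fun α => α.1.toLinear ℂ h L) (by
      rintro ⟨α, hα⟩
      obtain ⟨x, hx⟩ := Function.ne_iff.mp hα
      exact ⟨x, trivial, hx⟩)
  exact ⟨x, fun α hα => hx ⟨α, hα.1⟩⟩

variable {h b : LieSubalgebra ℂ L} [h.IsCartanSubalgebra]

/-- A subspace stable under a Cartan subalgebra is spanned by root vectors. -/
lemma le_of_forall_rootSpace {S T : Submodule ℂ L} (hS : ∀ x ∈ h, ∀ y ∈ S, ⁅x, y⁆ ∈ S)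
    (hT : ∀ χ : h → ℂ, ∀ y ∈ S, y ∈ rootSpace h χ → y ∈ T) : S ≤ T := by
  let S' : LieSubmodule ℂ h L := { S with lie_mem := fun {x y} hy => hS x x.2 y hy }
  have htop := LieModule.iSup_genWeightSpace_eq_top ℂ h S'
  have key : (⊤ : LieSubmodule ℂ h S').toSubmodule ≤ T.comap S'.toSubmodule.subtype := by
    rw [← htop, LieSubmodule.iSup_toSubmodule, iSup_le_iff]
    intro χ y hy
    have h1 : (y : L) ∈ rootSpace h χ :=
      LieModule.map_genWeightSpace_le S'.incl (LieSubmodule.mem_map_of_mem hy)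
    exact hT χ y y.2 h1
  exact fun y hy => key (x := ⟨y, hy⟩) trivial

lemma mem_cartan_of_mem_rootSpace {χ : h → ℂ} (hχ : χ = 0) {y : L} (hy : y ∈ rootSpace h χ) :
    y ∈ h := by
  rw [hχ, rootSpace_zero_eq] at hy
  exact hy

variable [LieAlgebra.IsSemisimple ℂ L]

lemma eq_zero_of_isNilpotent_ad {x : L} (hx : x ∈ h) (hn : IsNilpotent (ad ℂ L x)) : x = 0 :=
  eq_zero_of_ad_eq_zero (Module.End.eq_zero_of_isNilpotent_isSemisimple hn
    (IsKilling.isSemisimple_ad_of_mem_isCartanSubalgebra hx))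

lemma lie_eq_zero_of_mem {x y : L} (hx : x ∈ h) (hy : y ∈ h) : ⁅x, y⁆ = 0 := by
  have : IsLieAbelian h := inferInstance
  exact congrArg Subtype.val (this.trivial (⟨x, hx⟩ : h) ⟨y, hy⟩)

lemma lie_of_mem_rootSpace {χ : h → ℂ} {y : L} (hy : y ∈ rootSpace h χ) {x : L} (hx : x ∈ h) :
    ⁅x, y⁆ = χ ⟨x, hx⟩ • y := IsKilling.lie_eq_smul_of_mem_rootSpace hy ⟨x, hx⟩

lemma mem_of_mem_rootSpace {T : Submodule ℂ L} {χ : h → ℂ} (hχ : χ ≠ 0) {y : L}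
    (hy : y ∈ rootSpace h χ) (hT : ∀ x ∈ h, ⁅x, y⁆ ∈ T) : y ∈ T := by
  obtain ⟨x, hx⟩ := Function.ne_iff.mp hχ
  have h1 := hT x x.2
  rw [lie_of_mem_rootSpace hy x.2] at h1
  exact (Submodule.smul_mem_iff T hx).mp h1

/-- Decompose `b` under `h`: the zero weight part lies in `h`, and a vector of weight `χ ≠ 0` is a
scalar multiple of its bracket with some element of `h`. -/
lemma le_cartan_sup_derivedSpace (hhb : h ≤ b) :
    b.toSubmodule ≤ h.toSubmodule ⊔ derivedSpace b := by
  refine le_of_forall_rootSpace (h := h) (fun x hx y hy => b.lie_mem (hhb hx) hy)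
    fun χ y hy hyχ => ?_
  by_cases hχ : χ = 0
  · exact Submodule.mem_sup_left (mem_cartan_of_mem_rootSpace hχ hyχ)
  · exact mem_of_mem_rootSpace hχ hyχ
      fun x hx => Submodule.mem_sup_right (lie_mem_derivedSpace (hhb hx) hy)

/-- Such an element is ad-semisimple as a member of `h` and ad-nilpotent by Lie's theorem for `b`
acting on `L`. -/
lemma eq_zero_of_mem_cartan_of_mem_derivedSpace [LieAlgebra.IsSolvable b] {x : L} (hx : x ∈ h)
    (hx' : x ∈ derivedSpace b) : x = 0 := by
  obtain ⟨y, hy, rfl⟩ := hx'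
  exact eq_zero_of_isNilpotent_ad hx
    (isNilpotent_toEnd_of_mem_derivedSeries (K := b) (V := L) (x := y) hy)

/-- The centralizer of a Borel subalgebra in a Cartan subalgebra contained in it is trivial. -/
lemma eq_zero_of_centralizes (hb : IsBorel b) {x : L} (hx : x ∈ h)
    (hxb : ∀ y ∈ b, ⁅x, y⁆ = 0) : x = 0 := by
  have hss : (ad ℂ L x).IsSemisimple := IsKilling.isSemisimple_ad_of_mem_isCartanSubalgebra hx
  by_contra hne
  have hev : ∃ μ, (ad ℂ L x).HasEigenvalue μ ∧ μ ≠ 0 := by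
    by_contra! hno
    exact hne (eq_zero_of_ad_eq_zero (hss.eq_zero_iff_forall_eigenvalue.mpr hno))
  obtain ⟨μ, hμ, hμ0⟩ := hev
  -- Take an eigenvalue of largest modulus. Its eigenspace is abelian, since twice it is not an
  -- eigenvalue, and is stable under `b`, since `x` centralizes `b`. So it lies in `b`, where `x`
  -- acts as zero, a contradiction.
  obtain ⟨ev, hev, hmax⟩ := Set.exists_max_image {μ | (ad ℂ L x).HasEigenvalue μ} (fun μ => ‖μ‖)
    (Module.End.finite_hasEigenvalue _) ⟨μ, hμ⟩
  have hev0 : 0 < ‖ev‖ := (norm_pos_iff.mpr hμ0).trans_le (hmax μ hμ)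
  obtain ⟨v, hv, hv0⟩ := hev.exists_hasEigenvector
  have hle : (ad ℂ L x).eigenspace ev ≤ b.toSubmodule := by
    refine hb.le_of_abelian (fun y hy z hz => ?_) fun y hy z hz => ?_
    · rw [Module.End.mem_eigenspace_iff, ad_apply] at hz ⊢
      rw [leibniz_lie, hxb y hy, zero_lie, zero_add, hz, lie_smul]
    · by_contra hyz
      have h2 : (ad ℂ L x).HasEigenvalue (ev + ev) := by
        refine Module.End.hasEigenvalue_of_hasEigenvector (x := ⁅y, z⁆) ⟨?_, hyz⟩
        rw [Module.End.mem_eigenspace_iff, ad_apply] at hy hz ⊢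
        rw [leibniz_lie, hy, hz, smul_lie, lie_smul, add_smul]
      have h3 := hmax _ h2
      rw [← two_mul, norm_mul, Complex.norm_ofNat] at h3
      linarith
  have h4 := hxb v (hle hv)
  rw [Module.End.mem_eigenspace_iff, ad_apply, h4] at hv
  exact (smul_ne_zero (norm_pos_iff.mp hev0) hv0) hv.symm

/-- The nilradical of a Borel subalgebra is its derived algebra. -/
theorem lieNilradical_eq_derivedSeries (hb : IsBorel b) (hhb : h ≤ b) :
    lieNilradical b = derivedSeries ℂ b 1 := by
  have hbs : LieAlgebra.IsSolvable b := hb.prop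
  apply le_antisymm
  · refine sSup_le fun I (hI : LieRing.IsNilpotent I) => ?_
    have hle : I.toSubmodule.map b.toSubmodule.subtype ≤ derivedSpace b := by
      refine le_of_forall_rootSpace (h := h) ?_ ?_
      · rintro x hx _ ⟨y, hy, rfl⟩
        exact ⟨⁅(⟨x, hhb hx⟩ : b), y⁆, I.lie_mem hy, rfl⟩
      rintro χ _ ⟨y, hy, rfl⟩ hyχ
      by_cases hχ : χ = 0
      -- A weight zero vector of a nilpotent ideal acts on `b` both nilpotently and semisimply, so
      -- it centralizes `b` and vanishes.
      · have hyh : (y : L) ∈ h := mem_cartan_of_mem_rootSpace hχ hyχ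
        have hnil : IsNilpotent (ad ℂ b y) := by
          obtain ⟨k, hk⟩ := LieAlgebra.isNilpotent_iff_forall (R := ℂ).mp hI ⟨y, hy⟩
          -- One application of `ad y` moves `b` into the ideal; the remaining `k` annihilate it.
          refine ⟨k + 1, LinearMap.ext fun u => ?_⟩
          have hu : ad ℂ b y u ∈ I := by
            rw [ad_apply, ← lie_skew]
            exact I.neg_mem (I.lie_mem hy)
          have h1 := coe_ad_pow_ideal I ⟨y, hy⟩ k ⟨_, hu⟩
          rw [hk] at h1
          rw [pow_succ, Module.End.mul_apply]
          exact h1.symm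
        have hmaps : b.toSubmodule ∈ (ad ℂ L (y : L)).invtSubmodule :=
          fun u hu => b.lie_mem y.2 hu
        have hss := (IsKilling.isSemisimple_ad_of_mem_isCartanSubalgebra hyh).restrict hmaps
        have h0 := Module.End.eq_zero_of_isNilpotent_isSemisimple (f := ad ℂ b y) hnil hss
        have hy0 : (y : L) = 0 := eq_zero_of_centralizes hb hyh fun u hu =>
          congrArg Subtype.val (LinearMap.congr_fun h0 ⟨u, hu⟩)
        change (y : L) ∈ _
        rw [hy0]
        exact zero_mem _
      · exact mem_of_mem_rootSpace hχ hyχ fun x hx => lie_mem_derivedSpace (hhb hx) y.2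
    intro x hx
    obtain ⟨y, hy, hyx⟩ := hle ⟨x, hx, rfl⟩
    rwa [Subtype.ext hyx] at hy
  · refine le_sSup ?_
    change LieRing.IsNilpotent (derivedSeries ℂ b 1)
    rw [LieAlgebra.isNilpotent_iff_forall (R := ℂ)]
    rintro x
    obtain ⟨k, hk⟩ := isNilpotent_toEnd_of_mem_derivedSeries (V := b) x.2
    refine ⟨k, LinearMap.ext fun u => Subtype.ext ?_⟩
    rw [coe_ad_pow_ideal]
    exact LinearMap.congr_fun hk u

/-- An element of the Cartan subalgebra is not annihilated by any positive root if and only if it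
acts injectively on the derived algebra of the Borel subalgebra. -/
theorem forall_positiveRoots_iff (hb : IsBorel b) (hhb : h ≤ b) (x : h) :
    (∀ α ∈ positiveRoots h b, α x ≠ 0) ↔ ∀ z ∈ derivedSpace b, ⁅(x : L), z⁆ = 0 → z = 0 := by
  have hbs : LieAlgebra.IsSolvable b := hb.prop
  constructor
  · intro hx z hz hxz
    -- This kernel is stable under `h` because `h` is abelian, so it suffices to exclude root
    -- vectors from it.
    let S : Submodule ℂ L := derivedSpace b ⊓ LinearMap.ker (ad ℂ L (x : L))
    have hS : S ≤ ⊥ := by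
      refine le_of_forall_rootSpace (h := h) (fun u hu y hy => ⟨?_, ?_⟩) fun χ y hy hyχ => ?_
      · exact lie_mem_derivedSpace (hhb hu) (derivedSpace_le b hy.1)
      · have h1 : ⁅(x : L), y⁆ = 0 := hy.2
        change ⁅(x : L), ⁅u, y⁆⁆ = 0
        rw [leibniz_lie, lie_eq_zero_of_mem x.2 hu, h1, zero_lie, lie_zero, add_zero]
      · by_cases hχ : χ = 0
        · exact eq_zero_of_mem_cartan_of_mem_derivedSpace (mem_cartan_of_mem_rootSpace hχ hyχ) hy.1
        · by_contra hy0
          rw [Submodule.mem_bot] at hy0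
          have hne : rootSpace h χ ≠ ⊥ := fun hbot => hy0 (by rwa [hbot] at hyχ)
          let α : Weight ℂ h L := ⟨χ, hne⟩
          have hα : α.IsNonZero := hχ
          have hle : (rootSpace h α).toSubmodule ≤ b.toSubmodule := by
            intro u hu
            -- Root spaces are lines, so a single nonzero root vector in `b` already makes the root
            -- positive.
            obtain ⟨c, hc⟩ := (finrank_eq_one_iff_of_nonzero' (⟨y, hyχ⟩ : rootSpace h α)
              (fun h0 => hy0 (congrArg Subtype.val h0))).mp
              (IsKilling.finrank_rootSpace_eq_one α hα) ⟨u, hu⟩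
            have hcu : c • y = u := congrArg Subtype.val hc
            rw [← hcu]
            exact b.smul_mem c (derivedSpace_le b hy.1)
          have h1 : ⁅(x : L), y⁆ = 0 := hy.2
          rw [lie_of_mem_rootSpace hyχ x.2] at h1
          exact hx α ⟨hα, hle⟩ ((smul_eq_zero.mp h1).resolve_right hy0)
    exact hS ⟨hz, hxz⟩
  · rintro hx α ⟨hα, hle⟩ h0
    obtain ⟨v, hv, hv0⟩ := α.exists_ne_zero
    refine hv0 (hx v (mem_of_mem_rootSpace hα hv fun u hu =>
      lie_mem_derivedSpace (hhb hu) (hle hv)) ?_)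
    rw [lie_of_mem_rootSpace hv x.2]
    exact (congrArg (· • v) h0).trans (zero_smul ℂ v)

end Borel

/-! ### One-parameter families of matrices in a linear algebraic group -/

section OneParameter

open Polynomial

variable {m : ℕ}

lemma eval_aeval_matPoly (M : Fin m → Fin m → ℂ[X]) (t : ℂ) (p : MatPoly m) :
    (MvPolynomial.aeval (fun ij : Fin m × Fin m => M ij.1 ij.2) p).eval t =
      evalMat (Matrix.of fun i j => (M i j).eval t) p := by
  unfold evalMat
  induction p using MvPolynomial.induction_on with
  | C r => simp
  | add p q h1 h2 => simp only [map_add, eval_add, h1, h2]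
  | mul_X p ij h1 => simp [h1]

/-- The chain rule for a polynomial curve of matrices whose derivative at `t` is given by the
left-invariant vector field of `Z`. -/
lemma eval_derivative_aeval (M : Fin m → Fin m → ℂ[X]) (t : ℂ) (Z : Mat m)
    (hM : ∀ i j, (M i j).derivative.eval t = ∑ k, Z k j * (M i k).eval t) (p : MatPoly m) :
    (MvPolynomial.aeval (fun ij : Fin m × Fin m => M ij.1 ij.2) p).derivative.eval t =
      evalMat (Matrix.of fun i j => (M i j).eval t) (leftInvariantDerivation Z p) := by
  induction p using MvPolynomial.induction_on with
  | C r => simp [evalMat, ← MvPolynomial.algebraMap_eq]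
  | add p q h1 h2 =>
    simp only [map_add, eval_add, h1, h2]
    simp [evalMat]
  | mul_X p ij h1 =>
    have h2 := eval_aeval_matPoly M t p
    simp only [evalMat] at h1 h2 ⊢
    rw [map_mul, derivative_mul, eval_add, eval_mul, eval_mul, h1, h2, MvPolynomial.aeval_X, hM,
      Derivation.leibniz, leftInvariantDerivation_X]
    simp only [smul_eq_mul, map_add, map_mul, map_sum, MvPolynomial.eval_X, MvPolynomial.eval_C,
      Matrix.of_apply]
    ring

/-- The natural numbers are Zariski dense in `ℂ`; this passes from integer powers of a unipotent
element to its complex powers. -/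
lemma eq_zero_of_eval_natCast {q : ℂ[X]} (h : ∀ N : ℕ, q.eval (N : ℂ) = 0) : q = 0 := by
  refine Polynomial.eq_zero_of_infinite_isRoot q
    (Set.Infinite.mono ?_ (Set.infinite_range_of_injective (Nat.cast_injective (R := ℂ))))
  rintro _ ⟨N, rfl⟩
  exact h N

variable {G : Subgroup (GL (Fin m) ℂ)}

/-- The exponential of a nilpotent element of the Lie algebra of `G` lies in `G`. -/
theorem mem_of_exp (hG : IsAlgebraicGroup G) {Z : Mat m} (hZ : Z ∈ lieAlgebraOf G) {c : ℕ}
    (hc : Z ^ c = 0) {g : GL (Fin m) ℂ} (hg : (g : Mat m) = NormedSpace.exp Z) : g ∈ G := by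
  obtain ⟨S, hS⟩ := hG
  -- The entries of `e^(tZ)` as polynomials in `t`.
  let M : Fin m → Fin m → ℂ[X] := fun i j =>
    ∑ k ∈ Finset.range c, C ((k.factorial : ℂ)⁻¹ * (Z ^ k) i j) * X ^ k
  have hMeval : ∀ t i j, (M i j).eval t =
      ∑ k ∈ Finset.range c, (k.factorial : ℂ)⁻¹ * (Z ^ k) i j * t ^ k := fun t i j => by
    simp [M, eval_finsetSum]
  have hM : ∀ t i j, (M i j).derivative.eval t = ∑ k, Z k j * (M i k).eval t := by
    intro t i j
    have h1 : ∑ k, Z k j * (M i k).eval t =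
        ∑ l ∈ Finset.range c, (l.factorial : ℂ)⁻¹ * (Z ^ (l + 1)) i j * t ^ l := by
      simp only [hMeval, Finset.mul_sum, pow_succ, Matrix.mul_apply, Finset.sum_mul]
      rw [Finset.sum_comm]
      refine Finset.sum_congr rfl fun l _ => Finset.sum_congr rfl fun k _ => ?_
      ring
    rw [h1]
    rcases c with _ | c
    · simp [M]
    rw [Finset.sum_range_succ, hc]
    simp only [M, derivative_sum, eval_finsetSum]
    rw [Finset.sum_range_succ']
    simp only [derivative_C_mul, derivative_X_pow, eval_mul, eval_C, eval_pow, eval_X, pow_zero,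
      derivative_one, mul_zero, eval_zero, add_zero, Matrix.zero_apply, zero_mul,
      Nat.add_sub_cancel]
    refine Finset.sum_congr rfl fun l _ => ?_
    rw [Nat.factorial_succ]
    have h2 : (l.factorial : ℂ) ≠ 0 := Nat.cast_ne_zero.mpr l.factorial_ne_zero
    have h3 : ((l : ℂ) + 1) ≠ 0 := Nat.cast_add_one_ne_zero l
    push_cast
    field_simp
  let Q : MatPoly m → ℂ[X] := fun p =>
    MvPolynomial.aeval (fun ij : Fin m × Fin m => M ij.1 ij.2) p
  have hder : ∀ p, derivative (Q p) = Q (leftInvariantDerivation Z p) := fun p =>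
    Polynomial.funext fun t => by
      rw [eval_derivative_aeval M t Z (hM t), eval_aeval_matPoly]
  have hM0 : (Matrix.of fun i j => (M i j).eval 0 : Mat m) = 1 := by
    ext i j
    rw [Matrix.of_apply, hMeval]
    rcases c with _ | c
    · rw [pow_zero] at hc
      simp [hc]
    · rw [Finset.sum_range_succ']
      simp
  have hM1 : (Matrix.of fun i j => (M i j).eval 1 : Mat m) = g := by
    rw [hg, ← texp_eq_exp hc, texp]
    ext i j
    rw [Matrix.of_apply, hMeval, Matrix.sum_apply]
    simp
  -- Differentiating `p (e^(tZ))` replaces `p` by its derivative along `Z`, which again vanishes on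
  -- `G`. So all Taylor coefficients at zero vanish, and the polynomial is zero, in particular at `t
  -- = 1`.
  have hiter : ∀ (k : ℕ) p, VanishesOn G p → (derivative^[k] (Q p)).eval 0 = 0 := by
    intro k
    induction k with
    | zero =>
      intro p hp
      rw [Function.iterate_zero, id, eval_aeval_matPoly, hM0]
      simpa using hp 1 (one_mem _)
    | succ k ih =>
      intro p hp
      rw [Function.iterate_succ_apply, hder]
      exact ih _ (hZ p hp)
  rw [hS]
  intro p hp
  have hQ : Q p = 0 := by
    ext k
    have h1 := hiter k p fun x hx => (hS x).mp hx p hp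
    rw [← coeff_zero_eq_eval_zero, coeff_iterate_derivative, zero_add, Nat.descFactorial_self,
      nsmul_eq_mul] at h1
    rw [coeff_zero]
    exact (mul_eq_zero.mp h1).resolve_left (Nat.cast_ne_zero.mpr k.factorial_ne_zero)
  rw [← hM1, ← eval_aeval_matPoly]
  change (Q p).eval 1 = 0
  rw [hQ, eval_zero]

/-- The binomial coefficient `t choose k`, as a polynomial in `t`. -/
def binom (k : ℕ) : ℂ[X] := C ((k.factorial : ℂ)⁻¹) * descPochhammer ℂ k

lemma binom_eval_natCast (k N : ℕ) : (binom k).eval (N : ℂ) = (N.choose k : ℂ) := by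
  rw [binom, eval_mul, eval_C, descPochhammer_eval_eq_descFactorial,
    Nat.descFactorial_eq_factorial_mul_choose, Nat.cast_mul, inv_mul_cancel_left₀]
  exact Nat.cast_ne_zero.mpr k.factorial_ne_zero

lemma binom_eval_zero (k : ℕ) : (binom k).eval 0 = if k = 0 then 1 else 0 := by
  have h := binom_eval_natCast k 0
  rw [Nat.cast_zero] at h
  rw [h]
  rcases k with _ | k <;> simp

/-- The coefficients of the logarithm: the derivatives of the binomial coefficients at zero. -/
def logCoeff (k : ℕ) : ℂ := (binom k).derivative.eval 0

lemma logCoeff_zero : logCoeff 0 = 0 := by simp [logCoeff, binom]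

lemma logCoeff_one : logCoeff 1 = 1 := by simp [logCoeff, binom]

/-- The logarithm of `1 + a`, truncated after `c` terms. -/
def logSeries (c : ℕ) (a : Mat m) : Mat m := ∑ k ∈ Finset.range c, logCoeff k • a ^ k

lemma one_add_pow_eq {c : ℕ} {a : Mat m} (ha : a ^ c = 0) (N : ℕ) :
    (1 + a) ^ N = ∑ k ∈ Finset.range c, (binom k).eval (N : ℂ) • a ^ k := by
  have h1 : (1 + a) ^ N = ∑ k ∈ Finset.range (N + 1), (binom k).eval (N : ℂ) • a ^ k := by
    rw [add_comm, (Commute.one_right a).add_pow]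
    refine Finset.sum_congr rfl fun k _ => ?_
    rw [one_pow, mul_one, binom_eval_natCast, ← nsmul_eq_mul', Nat.cast_smul_eq_nsmul]
  rw [h1]
  have h2 : ∀ s t : ℕ, s ≤ t → (∀ k, s ≤ k → (binom k).eval (N : ℂ) • a ^ k = 0) →
      ∑ k ∈ Finset.range s, (binom k).eval (N : ℂ) • a ^ k =
      ∑ k ∈ Finset.range t, (binom k).eval (N : ℂ) • a ^ k := by
    intro s t hst h0
    refine Finset.sum_subset (Finset.range_mono hst) fun k _ hk => h0 k ?_
    simpa using hk
  rw [h2 (N + 1) (max (N + 1) c) (le_max_left _ _), h2 c (max (N + 1) c) (le_max_right _ _)]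
  · exact fun k hk => by rw [pow_eq_zero_of_le hk ha, smul_zero]
  · exact fun k hk => by
      rw [binom_eval_natCast, Nat.choose_eq_zero_of_lt hk, Nat.cast_zero, zero_smul]

/-- The logarithm of a unipotent element of a linear algebraic group lies in its Lie algebra. -/
theorem logSeries_mem_lieAlgebraOf {g : GL (Fin m) ℂ} (hg : g ∈ G) {c : ℕ}
    (hc : ((g : Mat m) - 1) ^ c = 0) : logSeries c ((g : Mat m) - 1) ∈ lieAlgebraOf G := by
  intro p hp y hy
  set a : Mat m := (g : Mat m) - 1
  -- The curve `y (1 + a)^t` given by the binomial series. It passes through `G` at natural `t`, so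
  -- `p` vanishes along all of it; its velocity at zero is `y * log g`.
  let M : Fin m → Fin m → ℂ[X] := fun i j =>
    ∑ k ∈ Finset.range c, binom k * C (((y : Mat m) * a ^ k) i j)
  have hMeval : ∀ t, (Matrix.of fun i j => (M i j).eval t : Mat m) =
      (y : Mat m) * ∑ k ∈ Finset.range c, (binom k).eval t • a ^ k := fun t => by
    ext i j
    simp [M, eval_finsetSum, Finset.mul_sum, Matrix.sum_apply]
  have hpow : ∀ N : ℕ, (Matrix.of fun i j => (M i j).eval (N : ℂ) : Mat m) =
      ((y * g ^ N : GL (Fin m) ℂ) : Mat m) := fun N => by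
    rw [hMeval, ← one_add_pow_eq hc, Units.val_mul, Units.val_pow_eq_pow_val]
    simp [a]
  have hM0 : (Matrix.of fun i j => (M i j).eval 0 : Mat m) = y := by
    have h := hpow 0
    rwa [pow_zero, mul_one, Nat.cast_zero] at h
  have hM : ∀ i j, (M i j).derivative.eval 0 =
      ∑ k, (logSeries c a) k j * (M i k).eval 0 := by
    intro i j
    have h1 : ∀ k, (M i k).eval 0 = (y : Mat m) i k := fun k => by rw [← hM0]; rfl
    have h2 : ∑ k, (logSeries c a) k j * (M i k).eval 0 = ((y : Mat m) * logSeries c a) i j := by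
      rw [Matrix.mul_apply]
      exact Finset.sum_congr rfl fun k _ => by rw [h1, mul_comm]
    rw [h2, logSeries, Finset.mul_sum, Matrix.sum_apply]
    simp [M, eval_finsetSum, logCoeff]
  have hzero : MvPolynomial.aeval (fun ij : Fin m × Fin m => M ij.1 ij.2) p = 0 :=
    eq_zero_of_eval_natCast fun N => by
      rw [eval_aeval_matPoly, hpow]
      exact hp _ (mul_mem hy (pow_mem hg N))
  have h := eval_derivative_aeval M 0 _ hM p
  rw [hzero, hM0, derivative_zero, eval_zero] at h
  exact h.symm

/-- The derivative at zero of `t ↦ g ^ t * y * g ^ (-t)`, tested against linear forms that vanish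
at natural numbers. -/
lemma dual_logSeries_eq_zero {g : GL (Fin m) ℂ} {c : ℕ} (hc : ((g : Mat m) - 1) ^ c = 0)
    (hc' : (((g⁻¹ : GL (Fin m) ℂ) : Mat m) - 1) ^ c = 0) (y : Mat m) (l : Module.Dual ℂ (Mat m))
    (hl : ∀ N : ℕ, l (((g ^ N : GL (Fin m) ℂ) : Mat m) * y *
      ((g⁻¹ ^ N : GL (Fin m) ℂ) : Mat m)) = l y) :
    l (logSeries c ((g : Mat m) - 1) * y +
      y * logSeries c (((g⁻¹ : GL (Fin m) ℂ) : Mat m) - 1)) = 0 := by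
  set a : Mat m := (g : Mat m) - 1 with ha
  set a' : Mat m := ((g⁻¹ : GL (Fin m) ℂ) : Mat m) - 1 with ha'
  -- The value of `l` on `g^t y g^(-t)`, with both powers expanded binomially. It is constant at
  -- natural `t`, hence constant.
  let q : ℂ[X] := ∑ i ∈ Finset.range c, ∑ j ∈ Finset.range c,
    binom i * binom j * C (l (a ^ i * y * a' ^ j))
  have hq : ∀ N : ℕ, (q - C (l y)).eval (N : ℂ) = 0 := by
    intro N
    have h1 := hl N
    rw [Units.val_pow_eq_pow_val, Units.val_pow_eq_pow_val,
      show (g : Mat m) = 1 + a by simp [ha],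
      show ((g⁻¹ : GL (Fin m) ℂ) : Mat m) = 1 + a' by simp [ha'],
      one_add_pow_eq hc, one_add_pow_eq hc', Finset.sum_mul, Finset.sum_mul, map_sum] at h1
    rw [eval_sub, eval_C, ← h1, sub_eq_zero]
    simp only [q, eval_finsetSum]
    refine Finset.sum_congr rfl fun i _ => ?_
    rw [Finset.mul_sum, map_sum]
    refine Finset.sum_congr rfl fun j _ => ?_
    rw [mul_smul_comm, smul_mul_assoc, smul_mul_assoc, map_smul, map_smul, eval_mul, eval_mul,
      eval_C, smul_eq_mul, smul_eq_mul]
    ring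
  have h2 : (derivative q).eval 0 = 0 := by
    rw [sub_eq_zero.mp (eq_zero_of_eval_natCast hq), derivative_C, eval_zero]
  rcases Nat.eq_zero_or_pos c with rfl | hpos
  · simp [logSeries]
  -- In the product rule the undifferentiated binomial is evaluated at zero, so only the terms with
  -- `i = 0` or `j = 0` survive; they assemble into the two logarithms.
  have h3 : (derivative q).eval 0 = ∑ i ∈ Finset.range c, ∑ j ∈ Finset.range c,
      ((logCoeff i * if j = 0 then 1 else 0) + (if i = 0 then 1 else 0) * logCoeff j) *
        l (a ^ i * y * a' ^ j) := by
    simp only [q, derivative_sum, eval_finsetSum, derivative_mul, derivative_C, mul_zero,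
      add_zero, eval_mul, eval_add, eval_C, binom_eval_zero]
    rfl
  rw [h3] at h2
  have hmem : 0 ∈ Finset.range c := Finset.mem_range.mpr hpos
  simp only [add_mul, Finset.sum_add_distrib, mul_ite, ite_mul, mul_one, mul_zero, zero_mul,
    one_mul, Finset.sum_ite_eq', hmem, if_true, pow_zero] at h2
  rw [Finset.sum_comm (s := Finset.range c)] at h2
  simp only [Finset.sum_ite_eq', hmem, if_true, pow_zero, one_mul] at h2
  rw [map_add, logSeries, logSeries, Finset.sum_mul, Finset.mul_sum, map_sum, map_sum]
  simpa only [smul_mul_assoc, mul_smul_comm, map_smul, smul_eq_mul] using h2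

lemma logSeries_inv {g : GL (Fin m) ℂ} {c : ℕ} (hc : ((g : Mat m) - 1) ^ c = 0)
    (hc' : (((g⁻¹ : GL (Fin m) ℂ) : Mat m) - 1) ^ c = 0) :
    logSeries c (((g⁻¹ : GL (Fin m) ℂ) : Mat m) - 1) = -logSeries c ((g : Mat m) - 1) := by
  rw [eq_neg_iff_add_eq_zero, add_comm]
  refine (Module.forall_dual_apply_eq_zero_iff ℂ _).mp fun l => ?_
  -- With `y = 1` the conjugates are constant for every linear form, and the derivative is the sum
  -- of the two logarithms.
  simpa using dual_logSeries_eq_zero hc hc' 1 l fun N => by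
    rw [mul_one, ← Units.val_mul, inv_pow, mul_inv_cancel, Units.val_one]

/-- If conjugation by the powers of a unipotent `g` preserves a subspace, then the logarithm of `g`
normalizes it. -/
lemma lie_logSeries_mem {g : GL (Fin m) ℂ} {c : ℕ} (hc : ((g : Mat m) - 1) ^ c = 0)
    (hc' : (((g⁻¹ : GL (Fin m) ℂ) : Mat m) - 1) ^ c = 0) {S : Submodule ℂ (Mat m)} {y : Mat m}
    (hy : y ∈ S) (hS : ∀ N : ℕ, ((g ^ N : GL (Fin m) ℂ) : Mat m) * y *
      ((g⁻¹ ^ N : GL (Fin m) ℂ) : Mat m) ∈ S) : ⁅logSeries c ((g : Mat m) - 1), y⁆ ∈ S := by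
  -- Linear forms on the quotient by `S` separate its points, and each of them kills every conjugate
  -- of `y`.
  rw [← Submodule.Quotient.mk_eq_zero]
  refine (Module.forall_dual_apply_eq_zero_iff ℂ _).mp fun l => ?_
  have h0 : ∀ u ∈ S, (l ∘ₗ S.mkQ) u = 0 := fun u hu => by
    rw [LinearMap.comp_apply, Submodule.mkQ_apply, (Submodule.Quotient.mk_eq_zero S).mpr hu,
      map_zero]
  have h := dual_logSeries_eq_zero hc hc' y (l ∘ₗ S.mkQ) fun N => by
    rw [h0 _ (hS N), h0 _ hy]
  rwa [logSeries_inv hc hc', mul_neg, ← sub_eq_add_neg,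
    ← LieRing.of_associative_ring_bracket] at h

lemma isNilpotent_sum_smul_pow_succ {c : ℕ} {a : Mat m} (ha : IsNilpotent a) (u : ℕ → ℂ) :
    IsNilpotent (∑ k ∈ Finset.range c, u k • a ^ (k + 1)) := by
  have h1 : ∑ k ∈ Finset.range c, u k • a ^ (k + 1) =
      a * ∑ k ∈ Finset.range c, u k • a ^ k := by
    rw [Finset.mul_sum]
    exact Finset.sum_congr rfl fun k _ => by rw [pow_succ', mul_smul_comm]
  rw [h1]
  refine Commute.isNilpotent_mul_right ?_ ha
  exact Commute.sum_right _ _ _ fun k _ => ((Commute.refl a).pow_right k).smul_right _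

lemma isNilpotent_logSeries {c : ℕ} {a : Mat m} (ha : a ^ c = 0) :
    IsNilpotent (logSeries c a) := by
  rcases c with _ | c
  · exact ⟨1, by simp [logSeries]⟩
  rw [logSeries, Finset.sum_range_succ', logCoeff_zero, zero_smul, add_zero]
  exact isNilpotent_sum_smul_pow_succ ⟨_, ha⟩ fun k => logCoeff (k + 1)

/-- The logarithm starts with `a`, so it factors as `a` times a unipotent, hence invertible, matrix.
-/
lemma eq_zero_of_logSeries_eq_zero {c : ℕ} {a : Mat m} (ha : a ^ c = 0)
    (h : logSeries c a = 0) : a = 0 := by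
  rcases c with _ | _ | c
  · rw [pow_zero] at ha
    rw [← mul_one a, ha, mul_zero]
  · rwa [zero_add, pow_one] at ha
  rw [logSeries, Finset.sum_range_succ', Finset.sum_range_succ', logCoeff_zero, zero_smul, add_zero,
    zero_add, logCoeff_one, one_smul, pow_one] at h
  have h1 : a * (1 + ∑ k ∈ Finset.range c, logCoeff (k + 1 + 1) • a ^ (k + 1)) = 0 := by
    rw [← h, mul_add, mul_one, add_comm, Finset.mul_sum]
    congr 1
    exact Finset.sum_congr rfl fun k _ => by rw [pow_succ' a (k + 1), mul_smul_comm]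
  have h2 := (isNilpotent_sum_smul_pow_succ (c := c) ⟨_, ha⟩ fun k => logCoeff (k + 1 + 1)).isUnit_one_add
  exact h2.mul_left_eq_zero.mp h1

lemma commute_logSeries {c : ℕ} {a x : Mat m} (h : Commute x a) : Commute x (logSeries c a) :=
  Commute.sum_right _ _ _ fun k _ => (h.pow_right k).smul_right _

end OneParameter

/-! ### The matrix filtration attached to a solvable Lie algebra. -/

section Filtration

open LieModule LieAlgebra

variable {m : ℕ}

/-- A solvable Lie algebra of matrices preserves a flag whose steps are lowered by its derived
algebra; the flag induces a filtration of the space of matrices. -/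
theorem exists_filtration {K : Type*} [LieRing K] [LieAlgebra ℂ K] [FiniteDimensional ℂ K]
    [LieAlgebra.IsSolvable K] (φ : K →ₗ⁅ℂ⁆ Mat m) :
    ∃ (c : ℕ) (F : ℕ → Submodule ℂ (Mat m)), 0 < c ∧ Antitone F ∧
      (∀ x ∈ derivedSeries ℂ K 1, φ x ∈ F 1) ∧ F c = ⊥ ∧
      (∀ k l, ∀ a ∈ F k, ∀ b ∈ F l, a * b ∈ F (k + l)) ∧
      ∀ k, ∀ x, ∀ a ∈ F k, ⁅φ x, a⁆ ∈ F k := by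
  let ψ : K →ₗ⁅ℂ⁆ Module.End ℂ (Fin m → ℂ) :=
    (lieEquivMatrix' (R := ℂ) (n := Fin m)).symm.toLieHom.comp φ
  let _ : LieRingModule K (Fin m → ℂ) := LieRingModule.compLieHom (Fin m → ℂ) ψ
  have _ : LieModule ℂ K (Fin m → ℂ) := LieModule.compLieHom (Fin m → ℂ) ψ
  have hact : ∀ (x : K) (v : Fin m → ℂ), ⁅x, v⁆ = (φ x).mulVec v := fun x v =>
    Matrix.toLin'_apply (φ x) v
  let J := derivedSeries ℂ K 1
  -- The flag is the lower central series of `ℂ^m` under the derived algebra `J`: its steps are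
  -- `K`-stable since `J` is an ideal, and it reaches zero by Engel's theorem because `J` acts by
  -- nilpotent endomorphisms. A matrix has degree `k` when it moves each step `k` places down.
  let V : ℕ → LieSubmodule ℂ K (Fin m → ℂ) := J.lcs (Fin m → ℂ)
  have hJ : LieModule.IsNilpotent J (Fin m → ℂ) := by
    rw [LieModule.isNilpotent_iff_forall (R := ℂ)]
    exact fun x => isNilpotent_toEnd_of_mem_derivedSeries (K := K) (x := x) x.2
  obtain ⟨d, hd⟩ := (LieModule.isNilpotent_iff ℂ J (Fin m → ℂ)).mp hJ
  have hVd : V d = ⊥ := by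
    rw [← LieSubmodule.toSubmodule_inj, LieIdeal.coe_lcs_eq, hd]
    rfl
  have hVanti : Antitone V := antitone_nat_of_succ_le fun i => by
    change J.lcs _ (i + 1) ≤ J.lcs _ i
    rw [LieIdeal.lcs_succ]
    exact LieSubmodule.lie_le_right _ _
  let F : ℕ → Submodule ℂ (Mat m) := fun k =>
    { carrier := {a | ∀ i, ∀ v ∈ V i, a.mulVec v ∈ V (i + k)}
      zero_mem' := fun i v _ => by rw [Matrix.zero_mulVec]; exact zero_mem _
      add_mem' := fun ha hb i v hv => by
        rw [Matrix.add_mulVec]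
        exact add_mem (ha i v hv) (hb i v hv)
      smul_mem' := fun r a ha i v hv => by
        rw [Matrix.smul_mulVec]
        exact (V (i + k)).smul_mem r (ha i v hv) }
  -- Using `d + 1` rather than `d` makes the length positive even if the flag is already zero at `d
  -- = 0`.
  refine ⟨d + 1, F, Nat.succ_pos d, fun k l hkl a ha i v hv =>
    hVanti (by omega) (ha i v hv), fun x hx i v hv => ?_, ?_, fun k l a ha b hb i v hv => ?_,
    fun k x a ha i v hv => ?_⟩
  · change (φ x).mulVec v ∈ J.lcs _ (i + 1)
    rw [← hact, LieIdeal.lcs_succ]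
    exact LieSubmodule.lie_mem_lie hx hv
  · rw [eq_bot_iff]
    intro a ha
    rw [Submodule.mem_bot, ← Matrix.toLin'.map_eq_zero_iff]
    refine LinearMap.ext fun v => ?_
    have h1 : a.mulVec v ∈ V (0 + (d + 1)) := ha 0 v (by
      change v ∈ J.lcs _ 0
      rw [LieIdeal.lcs_zero]
      trivial)
    have h2 : a.mulVec v ∈ V d := hVanti (by omega) h1
    rwa [hVd, LieSubmodule.mem_bot] at h2
  · rw [← Matrix.mulVec_mulVec, show i + (k + l) = i + l + k by ring]
    exact ha _ _ (hb i v hv)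
  · rw [LieRing.of_associative_ring_bracket, Matrix.sub_mulVec, ← Matrix.mulVec_mulVec,
      ← Matrix.mulVec_mulVec, ← hact, ← hact]
    exact sub_mem ((V _).lie_mem (ha i v hv)) (ha i _ ((V i).lie_mem hv))

end Filtration

/-! ### Application to a semisimple linear algebraic group. -/

section SemisimpleGroup

variable {m : ℕ} {G : Subgroup (GL (Fin m) ℂ)}

lemma mem_matSpace {K : LieSubalgebra ℂ (lieAlgebraOf G)} {x : lieAlgebraOf G} :
    (x : Mat m) ∈ matSpace K ↔ x ∈ K := by
  constructor
  · rintro ⟨y, hy, hyx⟩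
    rwa [Subtype.ext hyx] at hy
  · exact fun hx => ⟨x, hx, rfl⟩

lemma unipotentSubgroup_le (hG : IsAlgebraicGroup G)
    {h b : LieSubalgebra ℂ (lieAlgebraOf G)} {c : ℕ} {F : ℕ → Submodule ℂ (Mat m)}
    (hS : FilteredSplitting (matSpace h) (nilSpace b) (matSpace b) c F) :
    unipotentSubgroup b ≤ G := by
  refine (Subgroup.closure_le G).mpr ?_
  rintro g ⟨Z, hZ, hg⟩
  refine mem_of_exp hG ?_ (hS.pow_eq_zero_of_mem hZ) hg
  obtain ⟨z, -, rfl⟩ := hZ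
  exact z.2

lemma isNilpotent_ad_of_coe {z : lieAlgebraOf G} (hz : IsNilpotent (z : Mat m)) :
    IsNilpotent (LieAlgebra.ad ℂ (lieAlgebraOf G) z) := by
  obtain ⟨k, hk⟩ := LieAlgebra.ad_nilpotent_of_nilpotent (R := ℂ) hz
  have hpow : ∀ (j : ℕ) (y : lieAlgebraOf G), (((LieAlgebra.ad ℂ (lieAlgebraOf G) z ^ j) y :
      lieAlgebraOf G) : Mat m) = (LieAlgebra.ad ℂ (Mat m) (z : Mat m) ^ j) (y : Mat m) := by
    intro j
    induction j with
    | zero => exact fun y => rfl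
    | succ j ih =>
      intro y
      rw [pow_succ, pow_succ, Module.End.mul_apply, Module.End.mul_apply, ih]
      rfl
  refine ⟨k, LinearMap.ext fun y => Subtype.ext ?_⟩
  rw [hpow, hk]
  rfl

variable {h b : LieSubalgebra ℂ (lieAlgebraOf G)} [h.IsCartanSubalgebra]
  [LieAlgebra.IsSemisimple ℂ (lieAlgebraOf G)]

lemma nilSpace_eq (hb : IsBorel b) (hhb : h ≤ b) :
    nilSpace b = (derivedSpace b).map (lieAlgebraOf G).incl.toLinearMap := by
  rw [nilSpace, lieNilradical_eq_derivedSeries hb hhb]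
  rfl

lemma mem_nilSpace (hb : IsBorel b) (hhb : h ≤ b) {x : lieAlgebraOf G} :
    (x : Mat m) ∈ nilSpace b ↔ x ∈ derivedSpace b := by
  rw [nilSpace_eq hb hhb]
  constructor
  · rintro ⟨y, hy, hyx⟩
    rwa [Subtype.ext hyx] at hy
  · exact fun hx => ⟨x, hx, rfl⟩

lemma exists_filteredSplitting (hb : IsBorel b) (hhb : h ≤ b) :
    ∃ c F, FilteredSplitting (matSpace h) (nilSpace b) (matSpace b) c F := by
  have hbs : LieAlgebra.IsSolvable b := hb.prop
  obtain ⟨c, F, h1, h2, h3, h4, h5, h6⟩ := exists_filtration ((lieAlgebraOf G).incl.comp b.incl)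
  refine ⟨c, F, ?_, ?_, ?_, h2, ?_, h1, h4, h5, ?_⟩
  · rw [nilSpace_eq hb hhb, matSpace, matSpace, ← Submodule.map_sup]
    congr 1
    exact le_antisymm (sup_le hhb (derivedSpace_le b)) (le_cartan_sup_derivedSpace hhb)
  · rw [Submodule.disjoint_def]
    rintro _ ⟨x, hx, rfl⟩ hxn
    rw [eq_zero_of_mem_cartan_of_mem_derivedSpace hx ((mem_nilSpace hb hhb).mp hxn), map_zero]
  · rintro _ ⟨x, hx, rfl⟩ z hz
    rw [nilSpace_eq hb hhb] at hz
    obtain ⟨z, hz, rfl⟩ := hz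
    exact (mem_nilSpace hb hhb (x := ⁅x, z⁆)).mpr (lie_mem_derivedSpace hx (derivedSpace_le b hz))
  · rw [nilSpace_eq hb hhb]
    rintro _ ⟨_, ⟨z, hz, rfl⟩, rfl⟩
    exact h3 z hz
  · rintro k _ ⟨x, hx, rfl⟩ a ha
    exact h6 k ⟨x, hx⟩ a ha

/-- Translates the condition on positive roots into injectivity on `n`, the only form in which
regularity enters the matrix arguments. -/
lemma regularPart_eq (hb : IsBorel b) (hhb : h ≤ b) :
    regularPart h b = regularSet (matSpace h) (nilSpace b) := by
  ext X
  constructor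
  · rintro ⟨x, hx, rfl⟩
    refine ⟨mem_matSpace.mpr x.2, fun z hz h0 => ?_⟩
    rw [nilSpace_eq hb hhb] at hz
    obtain ⟨z, hz, rfl⟩ := hz
    rw [(forall_positiveRoots_iff hb hhb x).mp hx z hz (Subtype.ext h0), map_zero]
  · rintro ⟨⟨x, hx, rfl⟩, h1⟩
    refine ⟨⟨x, hx⟩, (forall_positiveRoots_iff hb hhb ⟨x, hx⟩).mpr fun z hz h0 => ?_, rfl⟩
    exact Subtype.ext (h1 z ((mem_nilSpace hb hhb).mpr hz) (congrArg Subtype.val h0))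

/-- The stabilizers of the regular elements in the unipotent subgroup are trivial. -/
lemma eq_one_of_commute_regular (hG : IsAlgebraicGroup G) (hb : IsBorel b) {c : ℕ}
    {F : ℕ → Submodule ℂ (Mat m)}
    (hS : FilteredSplitting (matSpace h) (nilSpace b) (matSpace b) c F)
    {g : GL (Fin m) ℂ} (hg : g ∈ expGroup (nilSpace b)) {x : Mat m}
    (hx : x ∈ regularSet (matSpace h) (nilSpace b)) (hgx : (g : Mat m) * x = x * (g : Mat m)) :
    g = 1 := by
  have hc := hS.pow_eq_zero (hS.sub_one_mem hg)
  have hc' := hS.pow_eq_zero (hS.sub_one_mem (inv_mem hg))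
  let z : lieAlgebraOf G := ⟨logSeries c ((g : Mat m) - 1),
    logSeries_mem_lieAlgebraOf (unipotentSubgroup_le hG hS hg) hc⟩
  -- Powers of `g` conjugate `b` into itself, so `log g` normalizes `b`, and a Borel subalgebra
  -- contains its normalizer.
  have hzb : z ∈ b := by
    refine hb.mem_of_normalizes fun u hu => mem_matSpace.mp ?_
    refine lie_logSeries_mem hc hc' (mem_matSpace.mpr hu) fun N => ?_
    have h1 := hS.conj_mem (pow_mem hg N) (mem_matSpace.mpr hu)
    rwa [← Matrix.coe_units_inv, ← inv_pow] at h1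
  have hxz : ⁅x, (z : Mat m)⁆ = 0 := by
    rw [← commute_iff_lie_eq]
    refine commute_logSeries (Commute.sub_right ?_ (Commute.one_right x))
    exact hgx.symm
  have hzB : (z : Mat m) ∈ matSpace h ⊔ nilSpace b := hS.sup_eq ▸ mem_matSpace.mpr hzb
  obtain ⟨_, ⟨z1, hz1, rfl⟩, z2, hz2, hz12⟩ := Submodule.mem_sup.mp hzB
  obtain ⟨⟨x, hxh, rfl⟩, hreg⟩ := hx
  -- `log g` commutes with `x` and so does its `h`-component, so its `n`-component does too;
  -- regularity makes that component vanish.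
  have hz2' : z2 = 0 := by
    refine hreg z2 hz2 ?_
    have h1 : ⁅((x : lieAlgebraOf G) : Mat m), ((z1 : lieAlgebraOf G) : Mat m)⁆ = 0 :=
      congrArg Subtype.val (lie_eq_zero_of_mem hxh hz1)
    rw [← hz12, lie_add] at hxz
    change ⁅((x : lieAlgebraOf G) : Mat m), ((z1 : lieAlgebraOf G) : Mat m)⁆ + _ = 0 at hxz
    rwa [h1, zero_add] at hxz
  have hzh : z ∈ h := by
    rw [hz2', add_zero] at hz12
    rwa [← show z1 = z from Subtype.ext hz12]
  -- Elements of `h` are ad-semisimple, while the logarithm of a unipotent matrix is nilpotent.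
  have hz0 : z = 0 := eq_zero_of_isNilpotent_ad hzh
    (isNilpotent_ad_of_coe (isNilpotent_logSeries hc))
  have h1 := eq_zero_of_logSeries_eq_zero hc (congrArg Subtype.val hz0)
  exact Units.ext (sub_eq_zero.mp h1)

theorem exists_freeSplitting (hG : IsAlgebraicGroup G) (hb : IsBorel b) (hhb : h ≤ b) :
    ∃ c F p π, FreeSplitting (matSpace h) (nilSpace b) (matSpace b) c F p π := by
  obtain ⟨c, F, hS⟩ := exists_filteredSplitting hb hhb
  obtain ⟨p, π, hP⟩ := exists_splitProjections hS.disjoint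
  refine ⟨c, F, p, π, hS, hP, fun g hg x hx => eq_one_of_commute_regular hG hb hS hg hx, ?_⟩
  obtain ⟨x, hx⟩ := exists_forall_positiveRoots_ne_zero h b
  rw [← regularPart_eq hb hhb]
  exact ⟨_, x, hx, rfl⟩

lemma borelRegularPart_eq (hb : IsBorel b) (hhb : h ≤ b) {c : ℕ} {F : ℕ → Submodule ℂ (Mat m)}
    {p π : Mat m →ₗ[ℂ] Mat m}
    (hS : FreeSplitting (matSpace h) (nilSpace b) (matSpace b) c F p π) :
    borelRegularPart h b = regularTarget (matSpace h) (nilSpace b) (matSpace b) p := by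
  ext Y
  constructor
  · rintro ⟨X, hX, Z, hZ, rfl⟩
    rw [regularPart_eq hb hhb] at hX
    refine ⟨add_mem (hS.h_le hX.1) (hS.n_le hZ), ?_⟩
    rwa [map_add, hS.fst_of_mem X hX.1, hS.fst_eq_zero Z hZ, add_zero]
  · rintro ⟨hY, hX⟩
    rw [← regularPart_eq hb hhb] at hX
    exact ⟨p Y, hX, π Y, hS.snd_mem Y, hS.fst_add_snd hY⟩

end SemisimpleGroup

end AdjointAction

end

theorem lemma1 {m : ℕ} (G : Subgroup (GL (Fin m) ℂ))
    (hG : IsAlgebraicGroup G)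
    (hss : LieAlgebra.IsSemisimple ℂ (lieAlgebraOf G))
    (h b : LieSubalgebra ℂ (lieAlgebraOf G))
    [h.IsCartanSubalgebra] (hb : IsBorel b) (hhb : h ≤ b) :
    unipotentSubgroup b ≤ G ∧
    -- the action map is an isomorphism of complex manifolds from `N × h'` onto `b'`
    (∃ charts : ChartedSpace (coordSpace (nilSpace b))
        (unipotentSubgroup b),
      IsEmbeddedSubmanifold (coordSpace (nilSpace b))
        (unipotentSubgroup b) ∧
      ∃ Φ : OpenPartialHomeomorph
          (unipotentSubgroup b ×
            coordSpace (matSpace h))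
          (coordSpace (matSpace b)),
        Φ.source = {p | toMat p.2 ∈ regularPart h b} ∧
        Φ.target = {y | toMat y ∈ borelRegularPart h b} ∧
        (∀ p ∈ Φ.source, toMat (Φ p) =
          ((p.1 : GL (Fin m) ℂ) : Mat m) * toMat p.2 *
            ((p.1 : GL (Fin m) ℂ) : Mat m)⁻¹) ∧
        ContMDiffOn
          (𝓘(ℂ, coordSpace (nilSpace b)).prod
            𝓘(ℂ, coordSpace (matSpace h)))
          𝓘(ℂ, coordSpace (matSpace b)) ω Φ Φ.source ∧
        ContMDiffOn 𝓘(ℂ, coordSpace (matSpace b))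
          (𝓘(ℂ, coordSpace (nilSpace b)).prod
            𝓘(ℂ, coordSpace (matSpace h)))
          ω Φ.symm Φ.target) ∧
    -- the action map is a birational equivalence from `N × h` to `b`
    IsBirationalEquivalence
      {p : Mat m × Mat m |
        (∃ g ∈ unipotentSubgroup b, (g : Mat m) = p.1) ∧
          p.2 ∈ matSpace h}
      (matSpace b : Set (Mat m))
      (fun p => p.1 * p.2 * p.1⁻¹) := by
  obtain ⟨c, F, p, π, hS⟩ := exists_freeSplitting hG hb hhb
  -- `unipotentSubgroup b` and `expGroup (nilSpace b)` agree by definition, so the general results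
  -- apply without rewriting the group.
  refine ⟨unipotentSubgroup_le hG hS.toFilteredSplitting, ?_, hS.isBirationalEquivalence⟩
  rw [regularPart_eq hb hhb, borelRegularPart_eq hb hhb hS]
  exact hS.exists_manifold_isomorphism
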